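/- Consider $n$ bosonic modes with annihilation operators $\hat a=(\hat a_1,\dots,\hat a_n)$, photon-number basis $\{|k\rangle\}_{k\in\mathbb{N}^n}$ and displacement operators $\hat D(\alpha)=\exp(\alpha\cdot\hat a^\dagger-\alpha^*\cdot\hat a)$, $\alpha\in\mathbb{C}^n$, where $x\cdot y=\sum_i x_iy_i$. The characteristic function of a state $\hat\rho$ is $\chi_{\hat\rho}(\alpha)=\mathrm{Tr}[\hat\rho\,\hat D(\alpha)]$. For a symmetric unitary matrix $U\in\mathbb{C}^{n\times n}$, the reflected state $\hat\rho^{(U)}$ is the state with $\chi_{\hat\rho^{(U)}}(\alpha)=\chi_{\hat\rho}(U\alpha^*)$ for all $\alpha$, and $\hat{\mathcal U}$ is the passive linear-optical unitary with $\hat{\mathcal U}^\dagger\hat D(\alpha)\hat{\mathcal U}=\hat D(U^{\mathsf T}\alpha)$. The continuous-variable Bell measurement of an input $\hat R$ on two $n$-mode systems has outcomes $\zeta\in\mathbb{C}^n$ with density, with respect to Lebesgue measure $d^{2n}\zeta$, $$p(\zeta)=\frac1{\pi^n}\langle\Psi|(I\otimes\hat D(\zeta)^\dagger)\,\hat R\,(I\otimes\hat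 D(\zeta))|\Psi\rangle,\qquad |\Psi\rangle=\sum_{k\in\mathbb{N}^n}|k\rangle|k\rangle,$$ read as the limit of the same expression with $|\Psi\rangle$ replaced by its truncations $\sum_{k\in K}|k\rangle|k\rangle$ to finite sets $K\subset\mathbb{N}^n$ increasing to $\mathbb{N}^n$. **Theorem.** There is a universal constant $C>0$ such that the following holds for every $n$, every symmetric unitary $U\in\mathbb{C}^{n\times n}$ and every $n$-mode state $\hat\rho$. The reflected state $\hat\rho^{(U)}$ exists. For the input $\hat R=\hat\rho\otimes\hat{\mathcal U}\hat\rho^{(U)}\hat{\mathcal U}^\dagger$ the limit defining $p(\zeta)$ exists for every $\zeta$, and $p$ is a probability density on $\mathbb{C}^n$. Let $\epsilon>0$, $\delta\in(0,1)$, let $M\ge 1$ be an integer with $M/\delta\ge 2$, and let $\alpha_1,\dots,\alpha_M\in\mathbb{C}^n$ be arbitrary points. If $N\ge C\,\epsilon^{-2}\log(M/\delta)$ and $\zeta^{(1)},\dots,\zeta^{(N)}$ are the independent outcomes of this measurement on $N$ copies of $\hat\rho\otimes\hat\rho^{(U)}$ (after applying $I\otimes\hat{\mathcal U}$ to each copy),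 then the empirical averages $$\hat v_i=\frac1N\sum_{j=1}^N e^{-(\zeta^{(j)}\cdot\alpha_i-\zeta^{(j)*}\cdot\alpha_i^*)}$$ satisfy $|\hat v_i-\chi_{\hat\rho}^2(\alpha_i)|\le\epsilon$ for all $i=1,\dots,M$ simultaneously with probability at least $1-\delta$. The measurement does not depend on the points $\alpha_i$. -/

import Mathlib

namespace CVBell

open MeasureTheory Filter Topology
open scoped ComplexConjugate TensorProduct ENNReal

noncomputable section

/-! ## The Hilbert space of `n` bosonic modes

The Segal–Bargmann realisation of the `n`-mode Fock space: entire functions `g` on `ℂⁿ` with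
`π⁻ⁿ ∫ |g(z)|² exp(-|z|²) d²ⁿz < ∞`. The creation operator `aᵢ†` is multiplication by `zᵢ`, the
annihilation operator `aᵢ` is `∂/∂zᵢ`, and the number states are the normalised monomials. -/

/-- The Gaussian weight `exp(-|z|²)`. -/
def weight {n : ℕ} (z : Fin n → ℂ) : ℝ := Real.exp (-∑ i, ‖z i‖ ^ 2)

lemma weight_pos {n : ℕ} (z : Fin n → ℂ) : 0 < weight z := Real.exp_pos _

lemma continuous_weight {n : ℕ} : Continuous (weight (n := n)) := by
  unfold weight; fun_prop

lemma integrable_prod {n : ℕ} {f g : (Fin n → ℂ) → ℂ} (hfc : Continuous f) (hgc : Continuous g)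
    (hf : Integrable (fun z => ‖f z‖ ^ 2 * weight z))
    (hg : Integrable (fun z => ‖g z‖ ^ 2 * weight z)) :
    Integrable (fun z => conj (f z) * g z * (weight z : ℂ)) := by
  have hw := continuous_weight (n := n)
  refine (hf.add hg).mono' ?_ (Eventually.of_forall fun z => ?_)
  · refine Continuous.aestronglyMeasurable ?_
    exact ((Complex.continuous_conj.comp hfc).mul hgc).mul (Complex.continuous_ofReal.comp hw)
  · have h := weight_pos z
    simp only [norm_mul, RCLike.norm_conj, Complex.norm_real, Real.norm_eq_abs, abs_of_pos h,
      Pi.add_apply]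
    have : ‖f z‖ * ‖g z‖ ≤ ‖f z‖ ^ 2 + ‖g z‖ ^ 2 := by
      nlinarith [sq_nonneg (‖f z‖ - ‖g z‖), sq_nonneg (‖f z‖ + ‖g z‖)]
    nlinarith

/-- Entire functions that are square integrable for the Gaussian weight. -/
def fockSubmodule (n : ℕ) : Submodule ℂ ((Fin n → ℂ) → ℂ) where
  carrier := {g | Differentiable ℂ g ∧ Integrable (fun z => ‖g z‖ ^ 2 * weight z)}
  zero_mem' := ⟨differentiable_const (0 : ℂ), by simp⟩
  add_mem' := by
    rintro f g ⟨hf, hf'⟩ ⟨hg, hg'⟩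
    refine ⟨hf.add hg, ((hf'.add hg').const_mul 2).mono' ?_ (Eventually.of_forall fun z => ?_)⟩
    · refine Continuous.aestronglyMeasurable ?_
      exact ((hf.continuous.add hg.continuous).norm.pow 2).mul continuous_weight
    · have h := weight_pos z
      have h1 := norm_add_le (f z) (g z)
      have h2 : ‖f z + g z‖ ^ 2 ≤ 2 * (‖f z‖ ^ 2 + ‖g z‖ ^ 2) := by
        nlinarith [sq_nonneg (‖f z‖ - ‖g z‖), norm_nonneg (f z + g z)]
      rw [Real.norm_of_nonneg (by positivity)]
      simp only [Pi.add_apply]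
      nlinarith
  smul_mem' := by
    rintro c f ⟨hf, hf'⟩
    refine ⟨hf.const_smul c, ?_⟩
    have : (fun z => ‖(c • f) z‖ ^ 2 * weight z) =
        fun z => ‖c‖ ^ 2 * (‖f z‖ ^ 2 * weight z) := by
      funext z; simp only [Pi.smul_apply, norm_smul]; ring
    rw [this]
    exact hf'.const_mul _

/-- The `n`-mode Hilbert space. -/
def Fock (n : ℕ) : Type := fockSubmodule n

instance (n : ℕ) : AddCommGroup (Fock n) := inferInstanceAs (AddCommGroup (fockSubmodule n))
instance (n : ℕ) : Module ℂ (Fock n) := inferInstanceAs (Module ℂ (fockSubmodule n))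

/-- The entire function underlying a vector of the Hilbert space. -/
def Fock.fn {n : ℕ} (g : Fock n) : (Fin n → ℂ) → ℂ := g.1

lemma Fock.differentiable {n : ℕ} (g : Fock n) : Differentiable ℂ g.fn := g.2.1

lemma Fock.integrable {n : ℕ} (g : Fock n) : Integrable (fun z => ‖g.fn z‖ ^ 2 * weight z) :=
  g.2.2

lemma Fock.ext {n : ℕ} {f g : Fock n} (h : ∀ z, f.fn z = g.fn z) : f = g :=
  Subtype.ext (funext h)

@[simp] lemma Fock.fn_add {n : ℕ} (f g : Fock n) (z : Fin n → ℂ) :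
    (f + g).fn z = f.fn z + g.fn z := rfl

@[simp] lemma Fock.fn_smul {n : ℕ} (c : ℂ) (g : Fock n) (z : Fin n → ℂ) :
    (c • g).fn z = c * g.fn z := rfl

lemma Fock.integrable_inner {n : ℕ} (f g : Fock n) :
    Integrable (fun z => conj (f.fn z) * g.fn z * (weight z : ℂ)) :=
  integrable_prod f.differentiable.continuous g.differentiable.continuous f.integrable g.integrable

/-- The inner product `⟪f, g⟫ = π⁻ⁿ ∫ conj (f z) g(z) exp(-|z|²) d²ⁿz`. -/
def fockInner {n : ℕ} (f g : Fock n) : ℂ :=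
  ((Real.pi ^ n)⁻¹ : ℝ) * ∫ z : Fin n → ℂ, conj (f.fn z) * g.fn z * (weight z : ℂ)

lemma fockInner_self {n : ℕ} (f : Fock n) :
    fockInner f f = (((Real.pi ^ n)⁻¹ * ∫ z : Fin n → ℂ, ‖f.fn z‖ ^ 2 * weight z : ℝ) : ℂ) := by
  have : (fun z => conj (f.fn z) * f.fn z * (weight z : ℂ)) =
      fun z => ((‖f.fn z‖ ^ 2 * weight z : ℝ) : ℂ) := by
    funext z
    rw [mul_comm (conj _), Complex.mul_conj, Complex.normSq_eq_norm_sq]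
    push_cast; ring
  rw [fockInner, this, integral_complex_ofReal]
  push_cast; ring

@[reducible] def fockCore (n : ℕ) : InnerProductSpace.Core ℂ (Fock n) where
  inner := fockInner
  conj_inner_symm f g := by
    simp only [fockInner, map_mul, Complex.conj_ofReal, ← integral_conj]
    congr 2
    funext z
    simp only [Complex.conj_conj]
    ring
  re_inner_nonneg f := by
    rw [fockInner_self]
    simp only [RCLike.re_to_complex, Complex.ofReal_re]
    have := integral_nonneg (μ := volume) (f := fun z : Fin n → ℂ => ‖f.fn z‖ ^ 2 * weight z)
      (fun z => mul_nonneg (by positivity) (weight_pos z).le)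
    have := Real.pi_pos
    positivity
  add_left f g h := by
    simp only [fockInner]
    rw [← mul_add, ← integral_add (f.integrable_inner h) (g.integrable_inner h)]
    congr 2
    funext z
    simp only [Fock.fn_add, map_add]; ring
  smul_left f g c := by
    simp only [fockInner]
    rw [mul_left_comm]
    congr 1
    rw [← integral_const_mul]
    congr 1
    funext z
    simp only [Fock.fn_smul, map_mul]; ring
  definite f hf := by
    have hf : fockInner f f = 0 := hf
    rw [fockInner_self, Complex.ofReal_eq_zero, mul_eq_zero] at hf
    have hpi : ((Real.pi ^ n)⁻¹ : ℝ) ≠ 0 := by have := Real.pi_pos; positivity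
    have h0 := hf.resolve_left hpi
    rw [integral_eq_zero_iff_of_nonneg
      (fun z => mul_nonneg (by positivity) (weight_pos z).le) f.integrable] at h0
    have hc : Continuous fun z => ‖f.fn z‖ ^ 2 * weight z :=
      (f.differentiable.continuous.norm.pow 2).mul continuous_weight
    have h1 := (hc.ae_eq_iff_eq volume continuous_zero).1 h0
    refine Fock.ext fun z => ?_
    have h2 : ‖f.fn z‖ ^ 2 * weight z = 0 := congrFun h1 z
    have h3 : ‖f.fn z‖ ^ 2 = 0 := (mul_eq_zero.1 h2).resolve_right (weight_pos z).ne'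
    have h4 : f.fn z = 0 := by simpa using h3
    exact h4

instance (n : ℕ) : NormedAddCommGroup (Fock n) := (fockCore n).toNormedAddCommGroup

instance (n : ℕ) : InnerProductSpace ℂ (Fock n) := InnerProductSpace.ofCore (fockCore n).toCore

lemma inner_eq_fockInner {n : ℕ} (f g : Fock n) : inner ℂ f g = fockInner f g := rfl

lemma Fock.norm_eq_of_integral_eq {n : ℕ} {f g : Fock n}
    (h : ∫ z, ‖f.fn z‖ ^ 2 * weight z = ∫ z, ‖g.fn z‖ ^ 2 * weight z) : ‖f‖ = ‖g‖ := by
  have : inner ℂ f f = inner ℂ g g := by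
    rw [inner_eq_fockInner, inner_eq_fockInner, fockInner_self, fockInner_self, h]
  rw [@norm_eq_sqrt_re_inner ℂ, @norm_eq_sqrt_re_inner ℂ, this]

/-! ## Number states -/

lemma integrable_monomial (k : ℕ) :
    Integrable (fun z : ℂ => ‖z‖ ^ (2 * k) * Real.exp (-‖z‖ ^ 2)) := by
  have h := Complex.integral_rpow_mul_exp_neg_rpow (p := 2) (q := ((2 * k : ℕ) : ℝ)) (by norm_num)
    (by have : (0 : ℝ) ≤ ((2 * k : ℕ) : ℝ) := Nat.cast_nonneg _
        linarith)
  refine Integrable.of_integral_ne_zero ?_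
  have h2 : ∀ x : ℝ, x ^ (2 : ℝ) = x ^ 2 := fun x => Real.rpow_ofNat x 2
  simp only [Real.rpow_natCast, h2] at h
  rw [h]
  have := Real.pi_pos
  have : 0 < Real.Gamma ((((2 * k : ℕ) : ℝ) + 2) / 2) := Real.Gamma_pos_of_pos (by positivity)
  positivity

/-- The photon number state `|k⟩ = |k₁⟩ ⊗ ⋯ ⊗ |kₙ⟩`, the function `∏ᵢ zᵢ^kᵢ / √(kᵢ!)`. -/
def numberState {n : ℕ} (k : Fin n → ℕ) : Fock n :=
  ⟨fun z => ∏ i, (z i ^ k i / (Real.sqrt (k i).factorial : ℂ)), by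
    refine ⟨by fun_prop, ?_⟩
    have h := Integrable.fintype_prod (ι := Fin n) (𝕜 := ℝ) (μ := fun _ => (volume : Measure ℂ))
      (f := fun i (z : ℂ) => (1 / (Real.sqrt (k i).factorial)) ^ 2 *
        (‖z‖ ^ (2 * k i) * Real.exp (-‖z‖ ^ 2)))
      (fun i => (integrable_monomial (k i)).const_mul _)
    refine h.congr (Eventually.of_forall fun z => ?_)
    simp only [weight, norm_prod, ← Finset.prod_pow, ← Finset.sum_neg_distrib, Real.exp_sum,
      ← Finset.prod_mul_distrib]
    refine Finset.prod_congr rfl fun i _ => ?_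
    rw [norm_div, norm_pow, Complex.norm_real, Real.norm_of_nonneg (Real.sqrt_nonneg _)]
    ring⟩

/-! ## Displacement operators -/

/-- The action of `D(α) = exp(α · a† - α* · a) = exp(-|α|²/2) exp(α · a†) exp(-α* · a)`,
`(D(α) g)(z) = exp(-|α|²/2 + α · z) g(z - α*)`, on functions. -/
def dispFun {n : ℕ} (α : Fin n → ℂ) (g : (Fin n → ℂ) → ℂ) (z : Fin n → ℂ) : ℂ :=
  Complex.exp (-((∑ i, ‖α i‖ ^ 2 : ℝ) : ℂ) / 2 + ∑ i, α i * z i) * g (z - star α)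

lemma dispFun_weight {n : ℕ} (α : Fin n → ℂ) (g : (Fin n → ℂ) → ℂ) (z : Fin n → ℂ) :
    ‖dispFun α g z‖ ^ 2 * weight z = ‖g (z - star α)‖ ^ 2 * weight (z - star α) := by
  have key : Real.exp ((-((∑ i, ‖α i‖ ^ 2 : ℝ) : ℂ) / 2 + ∑ i, α i * z i).re) ^ 2 * weight z
      = weight (z - star α) := by
    rw [weight, weight, ← Real.exp_nat_mul, ← Real.exp_add]
    congr 1
    have h1 : (-((∑ i, ‖α i‖ ^ 2 : ℝ) : ℂ) / 2 + ∑ i, α i * z i).re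
        = ∑ i, (-‖α i‖ ^ 2 / 2 + (α i * z i).re) := by
      rw [Finset.sum_add_distrib, Complex.add_re, Complex.re_sum, ← Finset.sum_div,
        Finset.sum_neg_distrib, ← Complex.ofReal_neg]
      norm_cast
    rw [h1, Finset.mul_sum, ← Finset.sum_neg_distrib, ← Finset.sum_add_distrib,
      ← Finset.sum_neg_distrib]
    refine Finset.sum_congr rfl fun i _ => ?_
    simp only [← Complex.normSq_eq_norm_sq, Complex.normSq_apply, Pi.sub_apply, Pi.star_apply,
      Complex.sub_re, Complex.sub_im, Complex.mul_re, RCLike.star_def, Complex.conj_re,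
      Complex.conj_im]
    push_cast
    ring
  rw [dispFun, norm_mul, Complex.norm_exp, mul_pow, ← key]
  ring

lemma dispFun_neg_dispFun {n : ℕ} (α : Fin n → ℂ) (g : (Fin n → ℂ) → ℂ) (z : Fin n → ℂ) :
    dispFun (-α) (dispFun α g) z = g z := by
  have hz : z - star (-α) - star α = z := by simp
  rw [dispFun, dispFun, hz, ← mul_assoc, ← Complex.exp_add]
  have : -((∑ i, ‖(-α) i‖ ^ 2 : ℝ) : ℂ) / 2 + ∑ i, (-α) i * z i +
      (-((∑ i, ‖α i‖ ^ 2 : ℝ) : ℂ) / 2 + ∑ i, α i * (z - star (-α)) i) = 0 := by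
    have h : ∑ i, α i * (z - star (-α)) i
        = ∑ i, α i * z i + ((∑ i, ‖α i‖ ^ 2 : ℝ) : ℂ) := by
      push_cast
      rw [← Finset.sum_add_distrib]
      refine Finset.sum_congr rfl fun i _ => ?_
      simp only [Pi.sub_apply, Pi.star_apply, Pi.neg_apply, star_neg, sub_neg_eq_add,
        RCLike.star_def, mul_add, Complex.mul_conj, Complex.normSq_eq_norm_sq]
      push_cast; ring
    rw [h]
    simp only [Pi.neg_apply, norm_neg, neg_mul, Finset.sum_neg_distrib]
    ring
  rw [this, Complex.exp_zero, one_mul]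

lemma dispFun_mem {n : ℕ} (α : Fin n → ℂ) (g : Fock n) : dispFun α g.fn ∈ fockSubmodule n := by
  refine ⟨?_, ?_⟩
  · have h1 : Differentiable ℂ fun z : Fin n → ℂ => g.fn (z - star α) :=
      g.differentiable.comp (differentiable_id.sub_const _)
    unfold dispFun
    exact Differentiable.mul (by fun_prop) h1
  · simp only [dispFun_weight]
    exact g.integrable.comp_sub_right (star α)

/-- The displacement operator `D(α)`, a unitary operator. -/
def D {n : ℕ} (α : Fin n → ℂ) : Fock n ≃ₗᵢ[ℂ] Fock n where
  toFun g := ⟨dispFun α g.fn, dispFun_mem α g⟩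
  map_add' f g := Fock.ext fun z => mul_add _ _ _
  map_smul' c g := Fock.ext fun z => mul_left_comm _ _ _
  invFun g := ⟨dispFun (-α) g.fn, dispFun_mem (-α) g⟩
  left_inv g := Fock.ext fun z => dispFun_neg_dispFun α g.fn z
  right_inv g := Fock.ext fun z => by
    have h := dispFun_neg_dispFun (-α) g.fn z
    rwa [neg_neg] at h
  norm_map' g := by
    refine Fock.norm_eq_of_integral_eq ?_
    change ∫ z, ‖dispFun α g.fn z‖ ^ 2 * weight z = _
    simp only [dispFun_weight]
    exact integral_sub_right_eq_self (fun z => ‖g.fn z‖ ^ 2 * weight z) (star α)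

/-! ## Passive linear optics -/

lemma weight_mulVec {n : ℕ} (A : Matrix.unitaryGroup (Fin n) ℂ) (z : Fin n → ℂ) :
    weight (A.1.mulVec z) = weight z := by
  have h : ∀ w : Fin n → ℂ, ((∑ i, ‖w i‖ ^ 2 : ℝ) : ℂ) = star w ⬝ᵥ w := by
    intro w
    simp only [dotProduct, Pi.star_apply, RCLike.star_def, Complex.ofReal_sum]
    refine Finset.sum_congr rfl fun i _ => ?_
    rw [mul_comm, Complex.mul_conj, Complex.normSq_eq_norm_sq]
  have h2 : ((∑ i, ‖A.1.mulVec z i‖ ^ 2 : ℝ) : ℂ) = ((∑ i, ‖z i‖ ^ 2 : ℝ) : ℂ) := by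
    rw [h, h, Matrix.star_mulVec, Matrix.dotProduct_mulVec, Matrix.vecMul_vecMul,
      ← Matrix.star_eq_conjTranspose, Matrix.UnitaryGroup.star_mul_self, Matrix.vecMul_one]
  rw [weight, weight, Complex.ofReal_injective h2]

lemma measurePreserving_mulVec {n : ℕ} (A : Matrix.unitaryGroup (Fin n) ℂ) :
    MeasurePreserving (fun z : Fin n → ℂ => A.1.mulVec z) := by
  set f : (Fin n → ℂ) →ₗ[ℝ] (Fin n → ℂ) := (Matrix.mulVecLin A.1).restrictScalars ℝ with hf
  have hA : ‖A.1.det‖ = 1 := CStarRing.norm_of_mem_unitary (Matrix.det_of_mem_unitary A.2)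
  have hdet : LinearMap.det f = 1 := by
    rw [hf, LinearMap.det_restrictScalars, ← Matrix.toLin'_apply', LinearMap.det_toLin',
      Algebra.norm_complex_apply, Complex.normSq_eq_norm_sq, hA, one_pow]
  refine ⟨(LinearMap.continuous_of_finiteDimensional f).measurable, ?_⟩
  have := Measure.map_linearMap_addHaar_eq_smul_addHaar (volume : Measure (Fin n → ℂ))
    (f := f) (by rw [hdet]; exact one_ne_zero)
  rw [hdet, inv_one, abs_one, ENNReal.ofReal_one, one_smul] at this
  exact this

lemma comp_mulVec_mem {n : ℕ} (A : Matrix.unitaryGroup (Fin n) ℂ) (g : Fock n) :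
    (fun z => g.fn (A.1.mulVec z)) ∈ fockSubmodule n := by
  refine ⟨?_, ?_⟩
  · exact g.differentiable.comp
      (LinearMap.toContinuousLinearMap (Matrix.mulVecLin A.1)).differentiable
  · have h := (measurePreserving_mulVec A).integrable_comp_of_integrable g.integrable
    refine h.congr (Eventually.of_forall fun z => ?_)
    simp only [Function.comp, weight_mulVec]

/-- The passive (beam splitter and phase shifter) unitary operator `𝒰` of a unitary matrix `U`,
`(𝒰 g)(z) = g(U† z)`; see `passive_symm_D_passive` for its action on displacements. -/
def passive {n : ℕ} (U : Matrix.unitaryGroup (Fin n) ℂ) : Fock n ≃ₗᵢ[ℂ] Fock n where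
  toFun g := ⟨fun z => g.fn ((star U).1.mulVec z), comp_mulVec_mem (star U) g⟩
  map_add' f g := rfl
  map_smul' c g := rfl
  invFun g := ⟨fun z => g.fn (U.1.mulVec z), comp_mulVec_mem U g⟩
  left_inv g := Fock.ext fun z => by
    change g.fn ((star U.1).mulVec (U.1.mulVec z)) = g.fn z
    rw [Matrix.mulVec_mulVec, Matrix.UnitaryGroup.star_mul_self, Matrix.one_mulVec]
  right_inv g := Fock.ext fun z => by
    change g.fn (U.1.mulVec ((star U.1).mulVec z)) = g.fn z
    rw [Matrix.mulVec_mulVec, Matrix.mem_unitaryGroup_iff.1 U.2, Matrix.one_mulVec]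
  norm_map' g := by
    refine Fock.norm_eq_of_integral_eq ?_
    change ∫ z, ‖g.fn ((star U).1.mulVec z)‖ ^ 2 * weight z = _
    have hm := measurePreserving_mulVec (star U)
    have h := hm.map_eq ▸ integral_map (μ := volume) hm.measurable.aemeasurable
      (f := fun z => ‖g.fn z‖ ^ 2 * weight z)
      (((g.differentiable.continuous.norm.pow 2).mul continuous_weight).aestronglyMeasurable)
    simp only [weight_mulVec] at h
    exact h.symm

/-- `𝒰† D(α) 𝒰 = D(Uᵀ α)`. -/
lemma passive_symm_D_passive {n : ℕ} (U : Matrix.unitaryGroup (Fin n) ℂ) (α : Fin n → ℂ)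
    (g : Fock n) : (passive U).symm (D α (passive U g)) = D (U.1.transpose.mulVec α) g := by
  refine Fock.ext fun z => ?_
  change dispFun α (fun z => g.fn ((star U.1).mulVec z)) (U.1.mulVec z)
    = dispFun (U.1.transpose.mulVec α) g.fn z
  have h0 : (∑ i, ‖U.1.transpose.mulVec α i‖ ^ 2 : ℝ) = ∑ i, ‖α i‖ ^ 2 := by
    have hU : U.1.transpose ∈ Matrix.unitaryGroup (Fin n) ℂ := by
      have h : star U.1.transpose = (star U.1).transpose := rfl
      rw [Matrix.mem_unitaryGroup_iff, h, ← Matrix.transpose_mul,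
        Matrix.UnitaryGroup.star_mul_self, Matrix.transpose_one]
    have h := weight_mulVec ⟨U.1.transpose, hU⟩ α
    simpa [weight] using h
  have h1 : ∑ i, α i * U.1.mulVec z i = ∑ i, U.1.transpose.mulVec α i * z i := by
    change α ⬝ᵥ U.1.mulVec z = U.1.transpose.mulVec α ⬝ᵥ z
    rw [Matrix.dotProduct_mulVec, Matrix.mulVec_transpose]
  have h2 : (star U.1).mulVec (U.1.mulVec z - star α) = z - star (U.1.transpose.mulVec α) := by
    rw [Matrix.mulVec_sub, Matrix.mulVec_mulVec, Matrix.UnitaryGroup.star_mul_self,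
      Matrix.one_mulVec, Matrix.mulVec_transpose, Matrix.star_vecMul,
      Matrix.star_eq_conjTranspose]
  simp only [dispFun, h0, h1, h2]

/-! ## States and characteristic functions -/

/-- An `n`-mode quantum state (density operator): a positive operator of trace one. -/
structure QState (n : ℕ) where
  op : Fock n →L[ℂ] Fock n
  isPositive : op.IsPositive
  trace_eq_one : HasSum (fun k => inner ℂ (numberState k) (op (numberState k))) 1

/-- The trace of an operator, computed in the photon number basis. -/
def trace {n : ℕ} (T : Fock n →L[ℂ] Fock n) : ℂ :=
  ∑' k : Fin n → ℕ, inner ℂ (numberState k) (T (numberState k))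

/-- The characteristic function `χ_ρ(α) = Tr[ρ D(α)]`. -/
def QState.χ {n : ℕ} (ρ : QState n) (α : Fin n → ℂ) : ℂ :=
  trace (ρ.op ∘L (D α : Fock n →L[ℂ] Fock n))

/-- `σ` is the reflected state `ρ^(U)`: `χ_σ(α) = χ_ρ(U α*)` for all `α`. -/
def IsReflected {n : ℕ} (U : Matrix.unitaryGroup (Fin n) ℂ) (ρ σ : QState n) : Prop :=
  ∀ α : Fin n → ℂ, σ.χ α = ρ.χ (U.1.mulVec (star α))

/-! ## The continuous-variable Bell measurement -/

/-- The joint input `ρ ⊗ 𝒰 σ 𝒰†` of the Bell measurement. -/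
def bellInput {n : ℕ} (U : Matrix.unitaryGroup (Fin n) ℂ) (ρ σ : QState n) :
    Fock n ⊗[ℂ] Fock n →L[ℂ] Fock n ⊗[ℂ] Fock n :=
  TensorProduct.mapL ρ.op
    ((passive U : Fock n →L[ℂ] Fock n) ∘L σ.op ∘L ((passive U).symm : Fock n →L[ℂ] Fock n))

/-- The truncation `∑_{k ∈ K} |k⟩ ⊗ D(ζ)|k⟩` of the unnormalised displaced Bell vector
`(I ⊗ D(ζ))|Ψ⟩`, where `|Ψ⟩ = ∑ₖ |k⟩|k⟩`. -/
def bellVec {n : ℕ} (K : Finset (Fin n → ℕ)) (ζ : Fin n → ℂ) : Fock n ⊗[ℂ] Fock n :=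
  ∑ k ∈ K, numberState k ⊗ₜ[ℂ] D ζ (numberState k)

/-- `π⁻ⁿ ⟨Ψ_K(ζ)| R |Ψ_K(ζ)⟩` for the truncated Bell vector `Ψ_K(ζ)`. -/
def bellDensityTrunc {n : ℕ} (R : Fock n ⊗[ℂ] Fock n →L[ℂ] Fock n ⊗[ℂ] Fock n)
    (K : Finset (Fin n → ℕ)) (ζ : Fin n → ℂ) : ℝ :=
  (Real.pi ^ n)⁻¹ * (inner ℂ (bellVec K ζ) (R (bellVec K ζ))).re

/-- The outcome density `p(ζ) = Tr[R Π(ζ)] = π⁻ⁿ ⟨Ψ| (I ⊗ D(ζ)†) R (I ⊗ D(ζ)) |Ψ⟩` of the Bell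
measurement on `R`, where `Π(ζ) = π⁻ⁿ (I ⊗ D(ζ))|Ψ⟩⟨Ψ|(I ⊗ D(ζ)†)`. -/
def bellDensity {n : ℕ} (R : Fock n ⊗[ℂ] Fock n →L[ℂ] Fock n ⊗[ℂ] Fock n)
    (ζ : Fin n → ℂ) : ℝ :=
  limUnder atTop fun K : Finset (Fin n → ℕ) => bellDensityTrunc R K ζ

/-- The law on `ℂⁿ` of one outcome of the Bell measurement. -/
def bellLaw {n : ℕ} (R : Fock n ⊗[ℂ] Fock n →L[ℂ] Fock n ⊗[ℂ] Fock n) :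
    Measure (Fin n → ℂ) :=
  volume.withDensity fun ζ => ENNReal.ofReal (bellDensity R ζ)

/-- The empirical average `N⁻¹ ∑ⱼ exp(-(ζⱼ · α - ζⱼ* · α*))`. -/
def estimator {n N : ℕ} (ζ : Fin N → Fin n → ℂ) (α : Fin n → ℂ) : ℂ :=
  (N : ℂ)⁻¹ * ∑ j, Complex.exp (-((ζ j) ⬝ᵥ α - star (ζ j) ⬝ᵥ star α))

end

end CVBell

/-!
The proof resolves every state into vectors, `ρ = ∑ⱼ |φⱼ⟩⟨φⱼ|` with `φⱼ = √ρ |j⟩`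
(`QState.exists_isMixture`), so that `χ_ρ(α) = ∑ⱼ ⟨φⱼ, D(α) φⱼ⟩` (`QState.hasSum_χ`) and every claim
about the Bell measurement reduces to product vectors `f ⊗ g`. Write `J` for complex conjugation in
the number basis. The truncated Bell vectors applied to `f ⊗ g` converge to the amplitude
`F(f ⊗ g)(ζ) = ⟨D(ζ) J f, g⟩` (`tendsto_inner_bellVec`), and dominated convergence gives
`p(ζ) = π⁻ⁿ ∑ |F(φⱼ ⊗ ψₘ)(ζ)|²` for the input `(∑ⱼ |φⱼ⟩⟨φⱼ|) ⊗ (∑ₘ |ψₘ⟩⟨ψₘ|)`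
(`bellDensity_mapL`).

Two facts about the amplitude determine the law of the outcome. It is an isometry from
`Fock n ⊗ Fock n` into `L²(π⁻ⁿ d²ⁿζ)` (`memLp_and_integral_bellAmp`): for coherent states this is a
Gaussian integral, which the reproducing property of the Bargmann space evaluates, and Fatou's lemma
carries it to limits. By the Weyl relations,
`F(D(α) f ⊗ D(α*) g)(ζ) = exp(-(ζ · α - ζ* · α*)) F(f ⊗ g)(ζ)` (`bellAmp_D_tmul_D`). Hence the mean
of `exp(-(ζ · α - ζ* · α*))` is the product of the expectations of `D(α)` in the first input and of
`D(α*)` in the second one. For `𝒰 ρ^(U) 𝒰†` as second input both factors equal `χ_ρ(α)`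
(`bellInput_law`), so the empirical averages have mean `χ_ρ(α)²`, and Hoeffding's inequality with a
union bound finishes the proof (`ofReal_le_measure_average`).

The reflected state is `W ρ W⁻¹` for the antiunitary `W = J 𝒱`, where `𝒱` is the passive unitary of
`-U` (`exists_isReflected`). The square root of `ρ` and the expansion in number states need the
completeness of the Bargmann space, which is proved by Cauchy's estimates, and the totality of
number states, which follows from that of coherent states.
-/

namespace CVBell

open MeasureTheory Filter Topology
open scoped ComplexConjugate TensorProduct ENNReal

noncomputable section

/-! ### Coherent states and the reproducing property -/

/-- The Gaussian integrals are invariant under unitary changes of variables. -/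
lemma integral_comp_mulVec {n : ℕ} (A : Matrix.unitaryGroup (Fin n) ℂ) {f : (Fin n → ℂ) → ℂ}
    (hf : Continuous f) : ∫ z, f (A.1.mulVec z) = ∫ z, f z := by
  have hm := measurePreserving_mulVec A
  rw [← integral_map hm.measurable.aemeasurable hf.aestronglyMeasurable, hm.map_eq]

lemma continuous_fn {n : ℕ} (g : Fock n) : Continuous g.fn := g.differentiable.continuous

/-- The scalar unitary matrix `c • 1`. -/
def phaseMatrix (n : ℕ) {c : ℂ} (hc : ‖c‖ = 1) : Matrix.unitaryGroup (Fin n) ℂ :=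
  ⟨c • 1, by
    rw [Matrix.mem_unitaryGroup_iff, star_smul, star_one, smul_mul_smul_comm, one_mul,
      RCLike.star_def, Complex.mul_conj, Complex.normSq_eq_norm_sq, hc]
    simp⟩

lemma phaseMatrix_mulVec {n : ℕ} {c : ℂ} (hc : ‖c‖ = 1) (z : Fin n → ℂ) :
    (phaseMatrix n hc).1.mulVec z = c • z := by
  simp [phaseMatrix, Matrix.smul_mulVec]

lemma weight_smul {n : ℕ} {c : ℂ} (hc : ‖c‖ = 1) (z : Fin n → ℂ) :
    weight (c • z) = weight z := by
  simp [weight, hc]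

lemma integral_comp_phase {n : ℕ} {c : ℂ} (hc : ‖c‖ = 1) {f : (Fin n → ℂ) → ℂ}
    (hf : Continuous f) : ∫ z, f (c • z) = ∫ z, f z := by
  simpa only [phaseMatrix_mulVec] using integral_comp_mulVec (phaseMatrix n hc) hf

lemma integral_monomial (k : ℕ) :
    ∫ z : ℂ, ‖z‖ ^ (2 * k) * Real.exp (-‖z‖ ^ 2) = Real.pi * k.factorial := by
  have h := Complex.integral_rpow_mul_exp_neg_rpow (p := 2) (q := ((2 * k : ℕ) : ℝ)) (by norm_num)
    (by have : (0 : ℝ) ≤ ((2 * k : ℕ) : ℝ) := Nat.cast_nonneg _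
        linarith)
  have h2 : ∀ x : ℝ, x ^ (2 : ℝ) = x ^ 2 := fun x => Real.rpow_ofNat x 2
  simp only [Real.rpow_natCast, h2] at h
  rw [h, show (((2 * k : ℕ) : ℝ) + 2) / 2 = k + 1 by push_cast; ring, Real.Gamma_nat_eq_factorial]
  ring

/-- Distinct monomials in one variable are orthogonal: a rotation by the angle `1` multiplies
the integrand by `exp (i (l - k)) ≠ 1`. -/
lemma integral_monomial_ne {k l : ℕ} (h : k ≠ l) :
    ∫ z : ℂ, conj (z ^ k) * z ^ l * (Real.exp (-‖z‖ ^ 2) : ℂ) = 0 := by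
  set c : Circle := Circle.exp 1 with hc
  have h1 := ((rotation c).measurePreserving).integral_comp
    (rotation c).toMeasurableEquiv.measurableEmbedding
    (fun z : ℂ => conj (z ^ k) * z ^ l * (Real.exp (-‖z‖ ^ 2) : ℂ))
  have h2 : ∀ z : ℂ, conj ((rotation c z) ^ k) * (rotation c z) ^ l *
      (Real.exp (-‖rotation c z‖ ^ 2) : ℂ) = (conj ((c : ℂ) ^ k) * (c : ℂ) ^ l) *
        (conj (z ^ k) * z ^ l * (Real.exp (-‖z‖ ^ 2) : ℂ)) := by
    intro z
    simp only [rotation_apply, mul_pow, map_mul, norm_mul, Circle.norm_coe, one_mul]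
    ring
  simp only [h2, integral_const_mul] at h1
  have h3 : conj ((c : ℂ) ^ k) * (c : ℂ) ^ l ≠ 1 := by
    intro h4
    have h5 : (c : ℂ) ^ l = (c : ℂ) ^ k := by
      have h6 : (c : ℂ) ^ k * conj ((c : ℂ) ^ k) = 1 := by
        rw [Complex.mul_conj, Complex.normSq_eq_norm_sq, norm_pow, Circle.norm_coe]; simp
      calc (c : ℂ) ^ l = ((c : ℂ) ^ k * conj ((c : ℂ) ^ k)) * (c : ℂ) ^ l := by rw [h6, one_mul]
        _ = (c : ℂ) ^ k * (conj ((c : ℂ) ^ k) * (c : ℂ) ^ l) := by ring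
        _ = _ := by rw [h4, mul_one]
    rw [hc, Circle.coe_exp, ← Complex.exp_nat_mul, ← Complex.exp_nat_mul,
      Complex.exp_eq_exp_iff_exists_int] at h5
    obtain ⟨m, hm⟩ := h5
    have h7 : (l : ℝ) = k + m * (2 * Real.pi) := by
      have h8 := congrArg Complex.im hm
      simpa using h8
    by_cases hm0 : m = 0
    · subst hm0
      simp only [Int.cast_zero, zero_mul, add_zero, Nat.cast_inj] at h7
      exact h h7.symm
    · refine irrational_pi.ne_rat (((l : ℚ) - k) / (2 * m)) ?_
      have : (m : ℝ) ≠ 0 := by exact_mod_cast hm0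
      push_cast
      rw [eq_div_iff (by positivity)]
      linarith
  by_contra h9
  exact h3 (mul_right_cancel₀ h9 (by rw [h1, one_mul]))

lemma orthonormal_numberState (n : ℕ) : Orthonormal ℂ (numberState (n := n)) := by
  classical
  rw [orthonormal_iff_ite]
  intro k l
  have h1 : inner ℂ (numberState k) (numberState l) = ((Real.pi ^ n)⁻¹ : ℝ) *
      ∏ i, ∫ z : ℂ, ((Real.sqrt (k i).factorial : ℂ)⁻¹ * (Real.sqrt (l i).factorial : ℂ)⁻¹) *
        (conj (z ^ k i) * z ^ l i * (Real.exp (-‖z‖ ^ 2) : ℂ)) := by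
    rw [inner_eq_fockInner, fockInner, ← integral_fintype_prod_volume_eq_prod]
    congr 2
    funext z
    simp only [Fock.fn, numberState, weight, ← Finset.sum_neg_distrib, Real.exp_sum, map_prod,
      Complex.ofReal_prod, ← Finset.prod_mul_distrib]
    refine Finset.prod_congr rfl fun i _ => ?_
    rw [map_div₀, Complex.conj_ofReal]
    ring
  rw [h1]
  simp only [integral_const_mul]
  split_ifs with h
  · subst h
    have h2 : ∀ i, ∫ z : ℂ, conj (z ^ k i) * z ^ k i * (Real.exp (-‖z‖ ^ 2) : ℂ)
        = (Real.pi * (k i).factorial : ℝ) := by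
      intro i
      rw [← integral_monomial, ← integral_complex_ofReal]
      congr 1
      funext z
      rw [mul_comm (conj _), Complex.mul_conj, Complex.normSq_eq_norm_sq]
      push_cast
      rw [norm_pow]; push_cast; ring
    have h3 : ∀ i, ((Real.sqrt (k i).factorial : ℂ)⁻¹ * (Real.sqrt (k i).factorial : ℂ)⁻¹) *
        ((Real.pi * (k i).factorial : ℝ) : ℂ) = (Real.pi : ℂ) := by
      intro i
      rw [← mul_inv, ← Complex.ofReal_mul, Real.mul_self_sqrt (Nat.cast_nonneg _)]
      have : ((k i).factorial : ℂ) ≠ 0 := by exact_mod_cast (k i).factorial_ne_zero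
      push_cast
      field_simp
    simp only [h2, h3, Finset.prod_const, Finset.card_univ, Fintype.card_fin]
    rw [← Complex.ofReal_pow, ← Complex.ofReal_mul, inv_mul_cancel₀ (by positivity)]
    rfl
  · obtain ⟨i, hi⟩ := Function.ne_iff.1 h
    rw [Finset.prod_eq_zero (Finset.mem_univ i) (by rw [integral_monomial_ne hi, mul_zero]),
      mul_zero]

/-- The vacuum, the constant function `1`. -/
def vacuum (n : ℕ) : Fock n := numberState 0

@[simp] lemma vacuum_fn {n : ℕ} (z : Fin n → ℂ) : (vacuum n).fn z = 1 := by
  simp [vacuum, numberState, Fock.fn]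

lemma norm_vacuum (n : ℕ) : ‖vacuum n‖ = 1 := (orthonormal_numberState n).1 0

lemma integral_weight (n : ℕ) : ∫ z : Fin n → ℂ, (weight z : ℂ) = (Real.pi ^ n : ℝ) := by
  have h : inner ℂ (vacuum n) (vacuum n) = (1 : ℂ) := by
    rw [inner_self_eq_norm_sq_to_K, norm_vacuum]; simp
  simp only [inner_eq_fockInner, fockInner, vacuum_fn, map_one, one_mul] at h
  have hpi : ((Real.pi ^ n : ℝ) : ℂ) ≠ 0 := by
    have := Real.pi_pos
    exact_mod_cast (by positivity : (Real.pi ^ n : ℝ) ≠ 0)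
  rw [Complex.ofReal_inv, inv_mul_eq_one₀ hpi] at h
  exact h.symm

lemma integrable_fn_weight {n : ℕ} (g : Fock n) :
    Integrable fun z => g.fn z * (weight z : ℂ) := by
  simpa using (vacuum n).integrable_inner g

/-- The mean value property of holomorphic functions along the circles `θ ↦ exp (iθ) z`. -/
lemma intervalIntegral_fn {n : ℕ} (g : Fock n) (z : Fin n → ℂ) :
    ∫ θ in (0 : ℝ)..2 * Real.pi, g.fn (Complex.exp (θ * Complex.I) • z)
      = 2 * Real.pi * g.fn 0 := by
  have hd : Differentiable ℂ fun w : ℂ => g.fn (w • z) :=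
    g.differentiable.comp (differentiable_id.smul_const z)
  have h := (hd.diffContOnCl (s := Metric.ball 0 |1|)).circleAverage
  rw [Real.circleAverage_def, zero_smul] at h
  simp only [circleMap, zero_add, Complex.ofReal_one, one_mul] at h
  rw [inv_smul_eq_iff₀ (by have := Real.pi_pos; positivity)] at h
  rw [h, Complex.real_smul]
  push_cast
  ring

/-- The Gaussian mean of a holomorphic function is its value at the origin. -/
lemma integral_fn_weight {n : ℕ} (g : Fock n) :
    ∫ z, g.fn z * (weight z : ℂ) = (Real.pi ^ n : ℝ) * g.fn 0 := by
  set c : ℝ → ℂ := fun θ => Complex.exp (θ * Complex.I) with hc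
  have hcn : ∀ θ, ‖c θ‖ = 1 := fun θ => Complex.norm_exp_ofReal_mul_I θ
  have hcc : Continuous c := by fun_prop
  have hg := continuous_fn g
  have hw : Continuous fun z : Fin n → ℂ => (weight z : ℂ) :=
    Complex.continuous_ofReal.comp continuous_weight
  have hF : Continuous fun p : ℝ × (Fin n → ℂ) => g.fn (c p.1 • p.2) * (weight p.2 : ℂ) :=
    (hg.comp (by fun_prop)).mul (hw.comp continuous_snd)
  have hrot : ∀ θ, ∫ z, g.fn (c θ • z) * (weight z : ℂ) = ∫ z, g.fn z * (weight z : ℂ) := by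
    intro θ
    simpa only [Pi.mul_apply, weight_smul (hcn θ)] using
      integral_comp_phase (hcn θ) (hg.mul hw)
  have hint : ∀ θ, Integrable fun z => g.fn (c θ • z) * (weight z : ℂ) := by
    intro θ
    have h := (measurePreserving_mulVec (phaseMatrix n (hcn θ))).integrable_comp_of_integrable
      (integrable_fn_weight g)
    simpa only [Function.comp_def, phaseMatrix_mulVec, weight_smul (hcn θ)] using h
  have hnorm : ∀ θ, ∫ z, ‖g.fn (c θ • z) * (weight z : ℂ)‖ = ∫ z, ‖g.fn z * (weight z : ℂ)‖ := by
    intro θ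
    apply Complex.ofReal_injective
    rw [← integral_complex_ofReal, ← integral_complex_ofReal]
    simpa only [Function.comp_def, Pi.mul_apply, weight_smul (hcn θ)] using
      integral_comp_phase (hcn θ) (Complex.continuous_ofReal.comp (hg.mul hw).norm)
  have hswap : Integrable (Function.uncurry fun (θ : ℝ) (z : Fin n → ℂ) =>
      g.fn (c θ • z) * (weight z : ℂ))
      ((volume.restrict (Set.uIoc 0 (2 * Real.pi))).prod volume) := by
    refine (integrable_prod_iff (by exact hF.aestronglyMeasurable)).2 ?_
    refine ⟨Eventually.of_forall hint, ?_⟩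
    simp only [Function.uncurry, hnorm]
    rw [Set.uIoc_of_le (by have := Real.pi_pos; positivity)]
    exact integrable_const _
  have h1 : ∫ θ in (0 : ℝ)..2 * Real.pi, ∫ z, g.fn (c θ • z) * (weight z : ℂ)
      = ∫ z, ∫ θ in (0 : ℝ)..2 * Real.pi, g.fn (c θ • z) * (weight z : ℂ) :=
    intervalIntegral_integral_swap hswap
  simp only [hrot, intervalIntegral.integral_mul_const, intervalIntegral.integral_const] at h1
  simp only [hc, intervalIntegral_fn, mul_assoc, integral_const_mul, integral_weight,
    sub_zero] at h1
  have hpi : (Real.pi : ℂ) ≠ 0 := by exact_mod_cast Real.pi_ne_zero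
  rw [Complex.real_smul] at h1
  push_cast at h1
  have h2 : (2 * (Real.pi : ℂ)) ≠ 0 := mul_ne_zero two_ne_zero hpi
  refine mul_left_cancel₀ h2 ?_
  rw [h1]
  push_cast
  ring

lemma inner_vacuum {n : ℕ} (g : Fock n) : inner ℂ (vacuum n) g = g.fn 0 := by
  have hpi : (Real.pi ^ n : ℝ) ≠ 0 := by have := Real.pi_pos; positivity
  simp only [inner_eq_fockInner, fockInner, vacuum_fn, map_one, one_mul]
  rw [integral_fn_weight, ← mul_assoc, ← Complex.ofReal_mul, inv_mul_cancel₀ hpi,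
    Complex.ofReal_one, one_mul]

/-- The coherent state `|α⟩ = D(α)|0⟩`. -/
def coherent {n : ℕ} (α : Fin n → ℂ) : Fock n := D α (vacuum n)

@[simp] lemma D_fn {n : ℕ} (α : Fin n → ℂ) (g : Fock n) (z : Fin n → ℂ) :
    (D α g).fn z = Complex.exp (-((∑ i, ‖α i‖ ^ 2 : ℝ) : ℂ) / 2 + ∑ i, α i * z i) *
      g.fn (z - star α) := rfl

lemma coherent_fn {n : ℕ} (α z : Fin n → ℂ) :
    (coherent α).fn z = Complex.exp (-((∑ i, ‖α i‖ ^ 2 : ℝ) : ℂ) / 2 + ∑ i, α i * z i) := by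
  simp [coherent]

lemma D_symm {n : ℕ} (α : Fin n → ℂ) (g : Fock n) : (D α).symm g = D (-α) g := rfl

lemma inner_D_left {n : ℕ} (α : Fin n → ℂ) (f g : Fock n) :
    inner ℂ (D α f) g = inner ℂ f (D (-α) g) := by
  rw [← D_symm, ← (D α).inner_map_map f, LinearIsometryEquiv.apply_symm_apply]

/-- The reproducing property: `⟨α|g⟩ = exp(-|α|²/2) g(α*)`. -/
lemma inner_coherent {n : ℕ} (α : Fin n → ℂ) (g : Fock n) :
    inner ℂ (coherent α) g =
      Complex.exp (-((∑ i, ‖α i‖ ^ 2 : ℝ) : ℂ) / 2) * g.fn (star α) := by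
  rw [coherent, inner_D_left, inner_vacuum, D_fn]
  simp

lemma norm_coherent {n : ℕ} (α : Fin n → ℂ) : ‖coherent α‖ = 1 := by
  rw [coherent, LinearIsometryEquiv.norm_map, norm_vacuum]

/-- Vectors are bounded, as functions, by the square root of the inverse weight. -/
lemma norm_fn_le {n : ℕ} (g : Fock n) (z : Fin n → ℂ) :
    ‖g.fn z‖ ≤ Real.exp ((∑ i, ‖z i‖ ^ 2) / 2) * ‖g‖ := by
  have h := norm_inner_le_norm (𝕜 := ℂ) (coherent (star z)) g
  rw [inner_coherent, norm_coherent, star_star, norm_mul, Complex.norm_exp] at h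
  have h2 : (-((∑ i, ‖(star z) i‖ ^ 2 : ℝ) : ℂ) / 2).re = -((∑ i, ‖z i‖ ^ 2) / 2) := by
    rw [← Complex.ofReal_neg, ← Complex.ofReal_ofNat 2, ← Complex.ofReal_div, Complex.ofReal_re]
    simp [neg_div]
  rw [h2, Real.exp_neg, one_mul, inv_mul_le_iff₀ (Real.exp_pos _)] at h
  exact h

/-! ### Completeness of the Bargmann space -/

/-- Cauchy's estimate for the derivative of an entire function of several variables. -/
lemma norm_fderiv_le_of_forall_closedBall {n : ℕ} {f : (Fin n → ℂ) → ℂ} (hf : Differentiable ℂ f)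
    {z : Fin n → ℂ} {C : ℝ} (hC : ∀ w ∈ Metric.closedBall z 1, ‖f w‖ ≤ C) :
    ‖fderiv ℂ f z‖ ≤ C := by
  have hC0 : 0 ≤ C := (norm_nonneg _).trans (hC z (by simp))
  refine ContinuousLinearMap.opNorm_le_bound _ hC0 fun v => ?_
  by_cases hv : v = 0
  · simp [hv]
  have hv' : 0 < ‖v‖ := norm_pos_iff.2 hv
  have hd : Differentiable ℂ fun t : ℂ => f (z + t • v) :=
    hf.comp ((differentiable_const z).add (differentiable_id.smul_const v))
  have h1 : HasDerivAt (fun t : ℂ => f (z + t • v)) (fderiv ℂ f z v) 0 := by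
    have h2 : HasDerivAt (fun t : ℂ => z + t • v) v 0 := by
      simpa using ((hasDerivAt_id (0 : ℂ)).smul_const v).const_add z
    have h3 : HasFDerivAt f (fderiv ℂ f z) (z + (0 : ℂ) • v) := by
      simpa using (hf z).hasFDerivAt
    exact h3.comp_hasDerivAt (0 : ℂ) h2
  have h4 := Complex.norm_deriv_le_of_forall_mem_sphere_norm_le (c := 0) (R := ‖v‖⁻¹) (C := C)
    (inv_pos.2 hv') hd.diffContOnCl (fun t ht => hC _ (by
      rw [mem_sphere_zero_iff_norm] at ht
      rw [mem_closedBall_iff_norm, add_sub_cancel_left, norm_smul, ht,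
        inv_mul_cancel₀ hv'.ne']))
  rw [h1.deriv, div_inv_eq_mul] at h4
  exact h4

@[simp] lemma Fock.fn_sub {n : ℕ} (f g : Fock n) : (f - g).fn = f.fn - g.fn := rfl

lemma norm_fn_le_of_norm_le {n : ℕ} (g : Fock n) {z : Fin n → ℂ} {r : ℝ} (hz : ‖z‖ ≤ r) :
    ‖g.fn z‖ ≤ Real.exp (n * r ^ 2) * ‖g‖ := by
  refine (norm_fn_le g z).trans (mul_le_mul_of_nonneg_right (Real.exp_le_exp.2 ?_) (norm_nonneg g))
  have h : ∑ i, ‖z i‖ ^ 2 ≤ ∑ _i : Fin n, r ^ 2 :=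
    Finset.sum_le_sum fun i _ => pow_le_pow_left₀ (norm_nonneg _) ((norm_le_pi_norm z i).trans hz) 2
  simp only [Finset.sum_const, Finset.card_univ, Fintype.card_fin, nsmul_eq_mul] at h
  have : 0 ≤ (n : ℝ) * r ^ 2 := by positivity
  linarith

lemma norm_fderiv_fn_le {n : ℕ} (g : Fock n) {z : Fin n → ℂ} {r : ℝ} (hz : ‖z‖ ≤ r) :
    ‖fderiv ℂ g.fn z‖ ≤ Real.exp (n * (r + 1) ^ 2) * ‖g‖ := by
  refine norm_fderiv_le_of_forall_closedBall g.differentiable fun w hw =>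
    norm_fn_le_of_norm_le g ?_
  rw [mem_closedBall_iff_norm] at hw
  linarith [norm_le_norm_add_norm_sub' w z]

lemma lintegral_fn {n : ℕ} (f : Fock n) :
    ∫⁻ z, ENNReal.ofReal (‖f.fn z‖ ^ 2 * weight z) = ENNReal.ofReal (Real.pi ^ n * ‖f‖ ^ 2) := by
  rw [← ofReal_integral_eq_lintegral_ofReal f.integrable
    (Eventually.of_forall fun z => mul_nonneg (by positivity) (weight_pos z).le)]
  congr 1
  have h : ((‖f‖ ^ 2 : ℝ) : ℂ) = inner ℂ f f := by
    rw [inner_self_eq_norm_sq_to_K]; norm_cast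
  rw [inner_eq_fockInner, fockInner_self] at h
  rw [Complex.ofReal_injective h, mul_inv_cancel_left₀]
  have := Real.pi_pos
  positivity

/-- A Cauchy sequence of vectors converges pointwise to an entire function: by Cauchy's estimate
the derivatives converge locally uniformly as well. -/
lemma exists_differentiable_tendsto {n : ℕ} {f : ℕ → Fock n} (hf : CauchySeq f) :
    ∃ g : (Fin n → ℂ) → ℂ, Differentiable ℂ g ∧
      ∀ z, Tendsto (fun m => (f m).fn z) atTop (𝓝 (g z)) := by
  have hb : ∀ (r ε : ℝ), 0 < ε → ∃ N, ∀ m ≥ N, ∀ l ≥ N,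
      Real.exp (n * r ^ 2) * ‖f m - f l‖ < ε := by
    intro r ε hε
    obtain ⟨N, hN⟩ := Metric.cauchySeq_iff.1 hf (ε / Real.exp (n * r ^ 2)) (by positivity)
    refine ⟨N, fun m hm l hl => ?_⟩
    have h := hN m hm l hl
    rw [dist_eq_norm, lt_div_iff₀ (Real.exp_pos _), mul_comm] at h
    exact h
  have hp : ∀ z, CauchySeq fun m => (f m).fn z := by
    intro z
    rw [Metric.cauchySeq_iff]
    intro ε hε
    obtain ⟨N, hN⟩ := hb ‖z‖ ε hε
    refine ⟨N, fun m hm l hl => lt_of_le_of_lt ?_ (hN m hm l hl)⟩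
    rw [dist_eq_norm]
    exact norm_fn_le_of_norm_le (f m - f l) le_rfl
  have hsub : ∀ m l z, fderiv ℂ (f m).fn z - fderiv ℂ (f l).fn z = fderiv ℂ (f m - f l).fn z :=
    fun m l z => (fderiv_sub ((f m).differentiable z) ((f l).differentiable z)).symm
  have hu : ∀ r : ℝ, UniformCauchySeqOn (fun m z => fderiv ℂ (f m).fn z) atTop
      (Metric.ball (0 : Fin n → ℂ) r) := by
    intro r
    rw [Metric.uniformCauchySeqOn_iff]
    intro ε hε
    obtain ⟨N, hN⟩ := hb (r + 1) ε hε
    refine ⟨N, fun m hm l hl z hz => lt_of_le_of_lt ?_ (hN m hm l hl)⟩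
    rw [dist_eq_norm, hsub]
    exact norm_fderiv_fn_le (f m - f l) (mem_ball_zero_iff.1 hz).le
  have hp' : ∀ z, CauchySeq fun m => fderiv ℂ (f m).fn z := by
    intro z
    rw [Metric.cauchySeq_iff]
    intro ε hε
    obtain ⟨N, hN⟩ := Metric.uniformCauchySeqOn_iff.1 (hu (‖z‖ + 1)) ε hε
    exact ⟨N, fun m hm l hl => hN m hm l hl z (by simp)⟩
  choose g hg using fun z => cauchySeq_tendsto_of_complete (hp z)
  choose g' hg' using fun z => cauchySeq_tendsto_of_complete (hp' z)
  refine ⟨g, fun z => ?_, hg⟩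
  exact (hasFDerivAt_of_tendstoUniformlyOn (Metric.isOpen_ball (x := (0 : Fin n → ℂ))
    (ε := ‖z‖ + 1)) ((hu _).tendstoUniformlyOn_of_tendsto fun w _ => hg' w)
    (fun m w _ => ((f m).differentiable w).hasFDerivAt) (fun w _ => hg w)
    (x := z) (by simp)).differentiableAt

instance (n : ℕ) : CompleteSpace (Fock n) := by
  refine Metric.complete_of_cauchySeq_tendsto fun f hf => ?_
  obtain ⟨g, hgd, hg⟩ := exists_differentiable_tendsto hf
  have hπ : 0 < Real.pi ^ n := by have := Real.pi_pos; positivity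
  -- Fatou's lemma turns the Cauchy property into square integrability of `g - f m`.
  have hfatou : ∀ ε > 0, ∃ N, ∀ m ≥ N,
      ∫⁻ z, ENNReal.ofReal (‖g z - (f m).fn z‖ ^ 2 * weight z)
        ≤ ENNReal.ofReal (Real.pi ^ n * ε ^ 2) := by
    intro ε hε
    obtain ⟨N, hN⟩ := Metric.cauchySeq_iff.1 hf ε hε
    refine ⟨N, fun m hm => ?_⟩
    have hlim : ∀ z, liminf (fun l => ENNReal.ofReal (‖(f l - f m).fn z‖ ^ 2 * weight z)) atTop
        = ENNReal.ofReal (‖g z - (f m).fn z‖ ^ 2 * weight z) := by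
      intro z
      refine Tendsto.liminf_eq (ENNReal.tendsto_ofReal ?_)
      exact ((((hg z).sub_const _).norm).pow 2).mul_const _
    calc ∫⁻ z, ENNReal.ofReal (‖g z - (f m).fn z‖ ^ 2 * weight z)
        = ∫⁻ z, liminf (fun l => ENNReal.ofReal (‖(f l - f m).fn z‖ ^ 2 * weight z)) atTop := by
          simp only [hlim]
      _ ≤ liminf (fun l => ∫⁻ z, ENNReal.ofReal (‖(f l - f m).fn z‖ ^ 2 * weight z)) atTop := by
          refine lintegral_liminf_le fun l => ?_
          have hc := (continuous_fn (f l - f m)).norm.pow 2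
          exact (hc.mul continuous_weight).measurable.ennreal_ofReal
      _ ≤ ENNReal.ofReal (Real.pi ^ n * ε ^ 2) := by
          refine liminf_le_of_le (by isBoundedDefault) fun b hb => ?_
          obtain ⟨l, hl1, hl2⟩ := (hb.and (eventually_ge_atTop N)).exists
          refine hl1.trans ?_
          rw [lintegral_fn]
          have h := (hN l hl2 m hm).le
          rw [dist_eq_norm] at h
          gcongr
  have hmem : ∀ ε > 0, ∃ N, ∀ m ≥ N, ∃ h : Fock n, h.fn = g - (f m).fn ∧ ‖h‖ ≤ ε := by
    intro ε hε
    obtain ⟨N, hN⟩ := hfatou ε hε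
    refine ⟨N, fun m hm => ?_⟩
    have hd : Differentiable ℂ (g - (f m).fn) := hgd.sub (f m).differentiable
    have hi : Integrable fun z => ‖(g - (f m).fn) z‖ ^ 2 * weight z := by
      refine ⟨((hd.continuous.norm.pow 2).mul continuous_weight).aestronglyMeasurable, ?_⟩
      rw [hasFiniteIntegral_iff_ofReal
        (Eventually.of_forall fun z => mul_nonneg (by positivity) (weight_pos z).le)]
      exact (hN m hm).trans_lt ENNReal.ofReal_lt_top
    let h : Fock n := ⟨g - (f m).fn, hd, hi⟩
    refine ⟨h, rfl, ?_⟩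
    have h1 : ENNReal.ofReal (Real.pi ^ n * ‖h‖ ^ 2) ≤ ENNReal.ofReal (Real.pi ^ n * ε ^ 2) := by
      rw [← lintegral_fn]; exact hN m hm
    rw [ENNReal.ofReal_le_ofReal_iff (by positivity), mul_le_mul_iff_right₀ hπ] at h1
    exact (pow_le_pow_iff_left₀ (norm_nonneg _) hε.le two_ne_zero).1 h1
  obtain ⟨N, hN⟩ := hmem 1 one_pos
  obtain ⟨h, hh, -⟩ := hN N le_rfl
  refine ⟨h + f N, Metric.tendsto_atTop.2 fun ε hε => ?_⟩
  obtain ⟨N', hN'⟩ := hmem (ε / 2) (by positivity)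
  refine ⟨N', fun m hm => ?_⟩
  obtain ⟨k, hk, hk'⟩ := hN' m hm
  have : h + f N - f m = k := by
    refine Fock.ext fun z => ?_
    simp only [Fock.fn_sub, Pi.sub_apply, Fock.fn_add, hh, hk]
    ring
  rw [dist_comm, dist_eq_norm, this]
  linarith

/-! ### Totality of coherent states and of number states -/

lemma eq_zero_of_inner_coherent {n : ℕ} {g : Fock n}
    (h : ∀ α, inner ℂ (coherent α) g = 0) : g = 0 := by
  refine Fock.ext fun z => ?_
  have h1 := h (star z)
  rw [inner_coherent, star_star] at h1
  exact (mul_eq_zero.1 h1).resolve_left (Complex.exp_ne_zero _)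

/-- Linear combinations of coherent states are dense. -/
lemma dense_span_coherent (n : ℕ) :
    Dense (Submodule.span ℂ (Set.range (coherent (n := n))) : Set (Fock n)) := by
  rw [Submodule.dense_iff_topologicalClosure_eq_top, Submodule.topologicalClosure_eq_top_iff,
    Submodule.eq_bot_iff]
  intro g hg
  rw [Submodule.mem_orthogonal] at hg
  exact eq_zero_of_inner_coherent fun α => hg _ (Submodule.subset_span ⟨α, rfl⟩)

lemma norm_sub_sum_sq {ι E : Type*} [NormedAddCommGroup E] [InnerProductSpace ℂ E] {v : ι → E}
    (hv : Orthonormal ℂ v) (x : E) (s : Finset ι) :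
    ‖x - ∑ i ∈ s, inner ℂ (v i) x • v i‖ ^ 2 = ‖x‖ ^ 2 - ∑ i ∈ s, ‖inner ℂ (v i) x‖ ^ 2 := by
  have h₂ : (∑ i ∈ s, ∑ j ∈ s, inner ℂ (v i) x * inner ℂ x (v j) * inner ℂ (v j) (v i))
      = (∑ k ∈ s, inner ℂ (v k) x * inner ℂ x (v k) : ℂ) := by
    classical exact hv.inner_left_right_finset
  have h₃ : ∀ z : ℂ, RCLike.re (z * conj z) = ‖z‖ ^ 2 := by
    intro z
    simp only [RCLike.mul_conj]
    norm_cast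
  rw [@norm_sub_sq ℂ, sub_add, sub_right_inj]
  simp only [@InnerProductSpace.norm_sq_eq_re_inner ℂ E, inner_sum, sum_inner]
  simp only [inner_smul_right, two_mul, inner_smul_left, inner_conj_symm, ← mul_assoc, h₂,
    add_sub_cancel_right]
  simp only [map_sum, ← inner_conj_symm x, ← h₃]

lemma norm_inner_numberState_coherent_sq {n : ℕ} (k : Fin n → ℕ) (α : Fin n → ℂ) :
    ‖inner ℂ (numberState k) (coherent α)‖ ^ 2
      = Real.exp (-∑ i, ‖α i‖ ^ 2) * ∏ i, (‖α i‖ ^ 2) ^ k i / (k i).factorial := by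
  rw [norm_inner_symm, inner_coherent, norm_mul, mul_pow, Complex.norm_exp, ← Real.exp_nat_mul]
  congr 1
  · congr 1
    rw [← Complex.ofReal_neg, ← Complex.ofReal_ofNat 2, ← Complex.ofReal_div, Complex.ofReal_re]
    push_cast; ring
  · simp only [Fock.fn, numberState, norm_prod, ← Finset.prod_pow]
    refine Finset.prod_congr rfl fun i _ => ?_
    rw [norm_div, norm_pow, Complex.norm_real, Real.norm_of_nonneg (Real.sqrt_nonneg _), div_pow,
      Real.sq_sqrt (Nat.cast_nonneg _), Pi.star_apply, norm_star]
    ring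

/-- A coherent state is the limit of its number state expansions along boxes: their squared norms
factor into partial sums of exponential series. -/
lemma coherent_mem_closure {n : ℕ} (α : Fin n → ℂ) :
    coherent α ∈ (Submodule.span ℂ (Set.range (numberState (n := n)))).topologicalClosure := by
  set K : ℕ → Finset (Fin n → ℕ) := fun N => Fintype.piFinset fun _ => Finset.range N
  have h1 : Tendsto (fun N => ∑ k ∈ K N, ‖inner ℂ (numberState k) (coherent α)‖ ^ 2) atTop
      (𝓝 1) := by
    have h2 : ∀ N, ∑ k ∈ K N, ‖inner ℂ (numberState k) (coherent α)‖ ^ 2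
        = Real.exp (-∑ i, ‖α i‖ ^ 2) *
          ∏ i, ∑ j ∈ Finset.range N, (‖α i‖ ^ 2) ^ j / j.factorial := by
      intro N
      simp only [norm_inner_numberState_coherent_sq, ← Finset.mul_sum]
      rw [Finset.prod_univ_sum]
    have h3 : (1 : ℝ) = Real.exp (-∑ i, ‖α i‖ ^ 2) * ∏ i, Real.exp (‖α i‖ ^ 2) := by
      rw [← Real.exp_sum, ← Real.exp_add, neg_add_cancel, Real.exp_zero]
    rw [h3]
    simp only [h2]
    refine Tendsto.const_mul _ (tendsto_finsetProd _ fun i _ => ?_)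
    have h4 := (NormedSpace.expSeries_div_hasSum_exp (𝔸 := ℝ) (‖α i‖ ^ 2)).tendsto_sum_nat
    rwa [← Real.exp_eq_exp_ℝ] at h4
  have h5 : Tendsto (fun N => ∑ k ∈ K N, inner ℂ (numberState k) (coherent α) • numberState k)
      atTop (𝓝 (coherent α)) := by
    rw [tendsto_iff_norm_sub_tendsto_zero]
    have h6 : Tendsto (fun N => Real.sqrt (1 - ∑ k ∈ K N,
        ‖inner ℂ (numberState k) (coherent α)‖ ^ 2)) atTop (𝓝 (Real.sqrt (1 - 1))) :=
      (Real.continuous_sqrt.tendsto _).comp (h1.const_sub 1)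
    rw [sub_self, Real.sqrt_zero] at h6
    refine h6.congr fun N => ?_
    rw [norm_sub_rev, ← Real.sqrt_sq (norm_nonneg (coherent α - _)),
      norm_sub_sum_sq (orthonormal_numberState n), norm_coherent, one_pow]
  refine mem_closure_of_tendsto h5 (Eventually.of_forall fun N => ?_)
  exact Submodule.sum_mem _ fun k _ => Submodule.smul_mem _ _ (Submodule.subset_span ⟨k, rfl⟩)

/-- The number states as a Hilbert basis. -/
def numberBasis (n : ℕ) : HilbertBasis (Fin n → ℕ) ℂ (Fock n) :=
  HilbertBasis.mk (orthonormal_numberState n) (by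
    have h : Submodule.span ℂ (Set.range (coherent (n := n))) ≤
        (Submodule.span ℂ (Set.range (numberState (n := n)))).topologicalClosure := by
      rw [Submodule.span_le]
      rintro _ ⟨α, rfl⟩
      exact coherent_mem_closure α
    rw [← (Submodule.dense_iff_topologicalClosure_eq_top.1 (dense_span_coherent n))]
    exact Submodule.topologicalClosure_minimal _ h (Submodule.isClosed_topologicalClosure _))

@[simp] lemma numberBasis_apply {n : ℕ} (k : Fin n → ℕ) : numberBasis n k = numberState k := by
  simp [numberBasis]

/-! ### Complex conjugation and the canonical commutation relations -/

lemma measurePreserving_star (n : ℕ) :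
    MeasurePreserving (fun z : Fin n → ℂ => star z) :=
  volume_preserving_pi fun _ => Complex.conjLIE.measurePreserving

lemma integral_comp_star {n : ℕ} {f : (Fin n → ℂ) → ℂ} (hf : Continuous f) :
    ∫ z, f (star z) = ∫ z, f z := by
  have hm := measurePreserving_star n
  rw [← integral_map hm.measurable.aemeasurable hf.aestronglyMeasurable, hm.map_eq]

lemma weight_star {n : ℕ} (z : Fin n → ℂ) : weight (star z) = weight z := by
  simp [weight]

lemma differentiable_conj_comp_star {n : ℕ} {f : (Fin n → ℂ) → ℂ} (hf : Differentiable ℂ f) :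
    Differentiable ℂ fun z => conj (f (star z)) := by
  intro z
  have h := (hf (star z)).hasFDerivAt
  set f' := fderiv ℂ f (star z)
  -- The derivative is `v ↦ conj (f' (star v))`, a linear map.
  let g' : (Fin n → ℂ) →ₗ[ℂ] ℂ :=
    { toFun := fun v => conj (f' (star v))
      map_add' := fun v w => by rw [star_add, map_add, map_add]
      map_smul' := fun c v => by simp [star_smul] }
  refine HasFDerivAt.differentiableAt (f' := LinearMap.toContinuousLinearMap g') ?_
  rw [hasFDerivAt_iff_isLittleO] at h ⊢
  have hs : Tendsto (fun w : Fin n → ℂ => star w) (𝓝 z) (𝓝 (star z)) :=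
    continuous_star.tendsto z
  have h2 := (h.comp_tendsto hs).norm_left.norm_right
  refine Asymptotics.IsLittleO.of_norm_left (Asymptotics.IsLittleO.of_norm_right ?_)
  refine h2.congr (fun w => ?_) (fun w => ?_)
  · simp only [Function.comp_apply, LinearMap.coe_toContinuousLinearMap']
    rw [← Complex.norm_conj]
    simp [g', map_sub]
  · simp only [Function.comp_apply]
    rw [← star_sub, norm_star]

lemma conj_comp_star_mem {n : ℕ} (g : Fock n) :
    (fun z => conj (g.fn (star z))) ∈ fockSubmodule n := by
  refine ⟨differentiable_conj_comp_star g.differentiable, ?_⟩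
  have h := (measurePreserving_star n).integrable_comp_of_integrable g.integrable
  simpa only [Function.comp_def, weight_star, RCLike.norm_conj] using h

/-- Complex conjugation in the number basis, `(J g)(z) = (g(z*))*`, an antilinear involution. -/
def conjFun {n : ℕ} (g : Fock n) : Fock n := ⟨fun z => conj (g.fn (star z)), conj_comp_star_mem g⟩

lemma conjFun_fn {n : ℕ} (g : Fock n) (z : Fin n → ℂ) :
    (conjFun g).fn z = conj (g.fn (star z)) := rfl

lemma inner_conjFun {n : ℕ} (f g : Fock n) : inner ℂ (conjFun f) (conjFun g) = inner ℂ g f := by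
  simp only [inner_eq_fockInner, fockInner]
  have h : Continuous fun z => conj (g.fn z) * f.fn z * (weight z : ℂ) :=
    (((Complex.continuous_conj.comp (continuous_fn g)).mul (continuous_fn f))).mul
      (Complex.continuous_ofReal.comp continuous_weight)
  rw [← integral_comp_star h]
  congr 2
  funext z
  rw [conjFun_fn, conjFun_fn, weight_star, Complex.conj_conj]
  ring

/-- Complex conjugation `J` as an antiunitary operator. -/
def J (n : ℕ) : Fock n ≃ₗᵢ⋆[ℂ] Fock n where
  toFun := conjFun
  map_add' f g := Fock.ext fun z => by simp [conjFun_fn]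
  map_smul' c g := Fock.ext fun z => by simp [conjFun_fn]
  invFun := conjFun
  left_inv g := Fock.ext fun z => by simp [conjFun_fn]
  right_inv g := Fock.ext fun z => by simp [conjFun_fn]
  norm_map' g := by
    change ‖conjFun g‖ = ‖g‖
    rw [@norm_eq_sqrt_re_inner ℂ, inner_conjFun, ← @norm_eq_sqrt_re_inner ℂ]

@[simp] lemma J_fn {n : ℕ} (g : Fock n) (z : Fin n → ℂ) :
    (J n g).fn z = conj (g.fn (star z)) := rfl

@[simp] lemma J_smul {n : ℕ} (c : ℂ) (g : Fock n) : J n (c • g) = conj c • J n g :=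
  (J n).map_smulₛₗ c g

lemma inner_J_J {n : ℕ} (f g : Fock n) : inner ℂ (J n f) (J n g) = inner ℂ g f :=
  inner_conjFun f g

lemma J_numberState {n : ℕ} (k : Fin n → ℕ) : J n (numberState k) = numberState k := by
  refine Fock.ext fun z => ?_
  rw [J_fn]
  simp only [Fock.fn, numberState, map_prod]
  refine Finset.prod_congr rfl fun i _ => ?_
  simp

/-- `J D(α) = D(α*) J`. -/
lemma J_D {n : ℕ} (α : Fin n → ℂ) (g : Fock n) : J n (D α g) = D (star α) (J n g) := by
  refine Fock.ext fun z => ?_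
  rw [J_fn, D_fn, D_fn, J_fn, map_mul, ← Complex.exp_conj, star_sub]
  simp [map_sum, map_ofNat]

lemma J_coherent {n : ℕ} (α : Fin n → ℂ) : J n (coherent α) = coherent (star α) := by
  rw [coherent, J_D, vacuum, J_numberState, coherent, vacuum]

lemma sum_norm_sq_eq {n : ℕ} (a : Fin n → ℂ) :
    ((∑ i, ‖a i‖ ^ 2 : ℝ) : ℂ) = ∑ i, a i * conj (a i) := by
  push_cast
  exact Finset.sum_congr rfl fun i _ => by
    rw [Complex.mul_conj, Complex.normSq_eq_norm_sq]; push_cast; rfl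

/-- The Weyl relation `D(-β*) D(ζ) D(β*) = exp(ζ · β - ζ* · β*) D(ζ)`. -/
lemma D_neg_D_D {n : ℕ} (β ζ : Fin n → ℂ) (g : Fock n) :
    D (-star β) (D ζ (D (star β) g))
      = Complex.exp (ζ ⬝ᵥ β - star ζ ⬝ᵥ star β) • D ζ g := by
  refine Fock.ext fun z => ?_
  rw [Fock.fn_smul]
  simp only [D_fn, ← mul_assoc, ← Complex.exp_add, sum_norm_sq_eq]
  have hz : z - star (-star β) - star ζ - star (star β) = z - star ζ := by
    rw [star_neg, star_star]; abel
  rw [hz]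
  congr 2
  rw [← sub_eq_zero]
  simp only [dotProduct, neg_div, Finset.sum_div, ← Finset.sum_neg_distrib,
    ← Finset.sum_add_distrib, ← Finset.sum_sub_distrib]
  refine Finset.sum_eq_zero fun i _ => ?_
  simp only [Pi.neg_apply, Pi.star_apply, Pi.sub_apply, RCLike.star_def, map_neg,
    Complex.conj_conj]
  ring

lemma inner_coherent_coherent {n : ℕ} (a b : Fin n → ℂ) :
    inner ℂ (coherent a) (coherent b) =
      Complex.exp (∑ i, (-(a i * conj (a i)) / 2 - b i * conj (b i) / 2 + b i * conj (a i))) := by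
  rw [inner_coherent, coherent_fn, ← Complex.exp_add, sum_norm_sq_eq, sum_norm_sq_eq]
  congr 1
  rw [← sub_eq_zero]
  simp only [neg_div, Finset.sum_div, ← Finset.sum_neg_distrib,
    ← Finset.sum_add_distrib, ← Finset.sum_sub_distrib]
  refine Finset.sum_eq_zero fun i _ => ?_
  simp only [Pi.star_apply, RCLike.star_def]
  ring

/-! ### The Bell amplitude -/

/-- The amplitude `⟨Ψ|(I ⊗ D(ζ)†)|f ⊗ g⟩ = ⟨D(ζ) J f, g⟩` of the Bell measurement at the outcome
`ζ`, linear in `f ⊗ g`; see `tendsto_inner_bellVec`. -/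
def bellAmp (n : ℕ) : Fock n ⊗[ℂ] Fock n →ₗ[ℂ] ((Fin n → ℂ) → ℂ) :=
  TensorProduct.lift (LinearMap.mk₂ ℂ (fun f g ζ => inner ℂ (D ζ (J n f)) g)
    (fun f f' g => by funext ζ; simp)
    (fun c f g => by funext ζ; simp [mul_comm])
    (fun f g g' => by funext ζ; simp)
    (fun c f g => by funext ζ; simp))

@[simp] lemma bellAmp_tmul {n : ℕ} (f g : Fock n) (ζ : Fin n → ℂ) :
    bellAmp n (f ⊗ₜ g) ζ = inner ℂ (D ζ (J n f)) g := rfl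

lemma norm_bellAmp_tmul_le {n : ℕ} (f g : Fock n) (ζ : Fin n → ℂ) :
    ‖bellAmp n (f ⊗ₜ g) ζ‖ ≤ ‖f‖ * ‖g‖ := by
  simpa using norm_inner_le_norm (𝕜 := ℂ) (D ζ (J n f)) g

lemma tendsto_bellAmp_tmul {n : ℕ} {ι : Type*} {l : Filter ι} {s r : ι → Fock n} {f g : Fock n}
    (hs : Tendsto s l (𝓝 f)) (hr : Tendsto r l (𝓝 g)) (ζ : Fin n → ℂ) :
    Tendsto (fun m => bellAmp n (s m ⊗ₜ r m) ζ) l (𝓝 (bellAmp n (f ⊗ₜ g) ζ)) := by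
  simp only [bellAmp_tmul]
  have h1 : Continuous fun f : Fock n => D ζ (J n f) := (D ζ).continuous.comp (J n).continuous
  exact ((h1.tendsto f).comp hs).inner hr

/-- A truncated Bell vector sees only the truncation of the first tensor factor. -/
lemma inner_bellVec_tmul {n : ℕ} (K : Finset (Fin n → ℕ)) (ζ : Fin n → ℂ) (f g : Fock n) :
    inner ℂ (bellVec K ζ) (f ⊗ₜ[ℂ] g)
      = bellAmp n ((∑ k ∈ K, inner ℂ (numberState k) f • numberState k) ⊗ₜ g) ζ := by
  simp [bellVec, sum_inner, map_sum, J_numberState, mul_comm]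

lemma hasSum_numberState {n : ℕ} (f : Fock n) :
    HasSum (fun k => inner ℂ (numberState k) f • numberState k) f := by
  simpa only [HilbertBasis.repr_apply_apply, numberBasis_apply] using (numberBasis n).hasSum_repr f

lemma tendsto_sum_numberState {n : ℕ} (f : Fock n) :
    Tendsto (fun K : Finset (Fin n → ℕ) =>
      ∑ k ∈ K, inner ℂ (numberState k) f • numberState k) atTop (𝓝 f) := by
  simpa only [HasSum, SummationFilter.unconditional_filter] using hasSum_numberState f

lemma tendsto_inner_bellVec {n : ℕ} (ζ : Fin n → ℂ) (f g : Fock n) :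
    Tendsto (fun K : Finset (Fin n → ℕ) => inner ℂ (bellVec K ζ) (f ⊗ₜ[ℂ] g)) atTop
      (𝓝 (bellAmp n (f ⊗ₜ g) ζ)) := by
  simp only [inner_bellVec_tmul]
  exact tendsto_bellAmp_tmul (tendsto_sum_numberState f) tendsto_const_nhds ζ

lemma norm_inner_bellVec_le {n : ℕ} (K : Finset (Fin n → ℕ)) (ζ : Fin n → ℂ) (f g : Fock n) :
    ‖inner ℂ (bellVec K ζ) (f ⊗ₜ[ℂ] g)‖ ≤ ‖f‖ * ‖g‖ := by
  rw [inner_bellVec_tmul]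
  refine (norm_bellAmp_tmul_le _ g ζ).trans (mul_le_mul_of_nonneg_right ?_ (norm_nonneg g))
  have hv := orthonormal_numberState n
  have h : ‖∑ k ∈ K, inner ℂ (numberState k) f • numberState k‖ ^ 2
      = ∑ k ∈ K, ‖inner ℂ (numberState k) f‖ ^ 2 := by
    rw [@InnerProductSpace.norm_sq_eq_re_inner ℂ, hv.inner_sum, map_sum]
    refine Finset.sum_congr rfl fun k _ => ?_
    rw [RCLike.conj_mul]
    norm_cast
  refine (pow_le_pow_iff_left₀ (norm_nonneg _) (norm_nonneg _) two_ne_zero).1 ?_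
  rw [h]
  exact hv.sum_inner_products_le f

/-- Displacing both factors multiplies the amplitude by a phase that is a character of the
outcome. This identity turns the characteristic function of the outcome law into an `L²` inner
product of amplitudes. -/
lemma bellAmp_D_tmul_D {n : ℕ} (α ζ : Fin n → ℂ) (f g : Fock n) :
    bellAmp n (D α f ⊗ₜ D (star α) g) ζ
      = Complex.exp (-(ζ ⬝ᵥ α - star ζ ⬝ᵥ star α)) * bellAmp n (f ⊗ₜ g) ζ := by
  rw [bellAmp_tmul, J_D, ← neg_neg (star α), ← inner_D_left, neg_neg, D_neg_D_D, inner_smul_left,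
    bellAmp_tmul, ← Complex.exp_conj]
  congr 2
  simp only [map_sub, dotProduct, map_sum, map_mul, Pi.star_apply, RCLike.star_def,
    Complex.conj_conj]
  ring

/-! ### Orthogonality relations -/

section Extension

variable {X H : Type*} [MeasurableSpace X] {μ : Measure X} [NormedAddCommGroup H]
  [InnerProductSpace ℂ H]

lemma integrable_conj_mul {f g : X → ℂ} (hf : MemLp f 2 μ) (hg : MemLp g 2 μ) :
    Integrable (fun x => conj (f x) * g x) μ := by
  have h := hf.star.integrable_mul hg
  exact h

lemma inner_toLp {f g : X → ℂ} (hf : MemLp f 2 μ) (hg : MemLp g 2 μ) :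
    inner ℂ (hf.toLp f) (hg.toLp g) = ∫ x, conj (f x) * g x ∂μ := by
  rw [L2.inner_def]
  refine integral_congr_ae ?_
  filter_upwards [hf.coeFn_toLp, hg.coeFn_toLp] with x h1 h2
  rw [h1, h2, RCLike.inner_apply, mul_comm]

lemma eLpNorm_two_eq {f : X → ℂ} (hf : MemLp f 2 μ) {r : ℝ} (hr : 0 ≤ r)
    (h : ∫ x, conj (f x) * f x ∂μ = (r : ℂ) ^ 2) : eLpNorm f 2 μ = ENNReal.ofReal r := by
  rw [← Lp.enorm_toLp hf, ← ofReal_norm]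
  congr 1
  have h1 : inner ℂ (hf.toLp f) (hf.toLp f) = (r : ℂ) ^ 2 := by rw [inner_toLp, h]
  rw [inner_self_eq_norm_sq_to_K] at h1
  have h2 : ‖hf.toLp f‖ ^ 2 = r ^ 2 := Complex.ofReal_injective (by push_cast; exact h1)
  exact (pow_left_inj₀ (norm_nonneg _) hr two_ne_zero).1 h2

/-- A linear map into functions that is isometric into `L²` on a set `A` extends to an isometry
into `L²` on every vector that is a limit of the span of `A` along a sequence on which the functions
also converge pointwise: by Fatou's lemma the pointwise limit is the limit in `L²`. -/
lemma memLp_and_integral_eq_inner_of_approx (F : H →ₗ[ℂ] X → ℂ) (A : Set H)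
    (hA : ∀ a ∈ A, MemLp (F a) 2 μ)
    (hAB : ∀ a ∈ A, ∀ b ∈ A, ∫ x, conj (F a x) * F b x ∂μ = inner ℂ a b)
    (happ : ∀ t, ∃ s : ℕ → H, (∀ m, s m ∈ Submodule.span ℂ A) ∧ Tendsto s atTop (𝓝 t) ∧
      ∀ x, Tendsto (fun m => F (s m) x) atTop (𝓝 (F t x))) :
    (∀ t, MemLp (F t) 2 μ) ∧ ∀ t t', ∫ x, conj (F t x) * F t' x ∂μ = inner ℂ t t' := by
  have hS : ∀ s ∈ Submodule.span ℂ A, MemLp (F s) 2 μ := by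
    intro s hs
    induction hs using Submodule.span_induction with
    | mem a ha => exact hA a ha
    | zero => rw [map_zero]; exact MemLp.zero
    | add a b _ _ ha hb => rw [map_add]; exact ha.add hb
    | smul c a _ ha => rw [map_smul]; exact ha.const_smul c
  have hS1 : ∀ a ∈ A, ∀ s ∈ Submodule.span ℂ A,
      ∫ x, conj (F a x) * F s x ∂μ = inner ℂ a s := by
    intro a ha s hs
    induction hs using Submodule.span_induction with
    | mem b hb => exact hAB a ha b hb
    | zero => simp
    | add b c hb hc ihb ihc =>
      simp only [map_add, Pi.add_apply, mul_add, inner_add_right]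
      rw [integral_add (integrable_conj_mul (hA a ha) (hS b hb))
        (integrable_conj_mul (hA a ha) (hS c hc)), ihb, ihc]
    | smul c b hb ihb =>
      simp only [map_smul, Pi.smul_apply, smul_eq_mul, mul_left_comm _ c, inner_smul_right]
      rw [integral_const_mul, ihb]
  have hS2 : ∀ t ∈ Submodule.span ℂ A, ∀ s ∈ Submodule.span ℂ A,
      ∫ x, conj (F t x) * F s x ∂μ = inner ℂ t s := by
    intro t ht s hs
    induction ht using Submodule.span_induction with
    | mem b hb => exact hS1 b hb s hs
    | zero => simp
    | add b c hb hc ihb ihc =>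
      simp only [map_add, Pi.add_apply, add_mul, inner_add_left]
      rw [integral_add (integrable_conj_mul (hS b hb) (hS s hs))
        (integrable_conj_mul (hS c hc) (hS s hs)), ihb, ihc]
    | smul c b hb ihb =>
      simp only [map_smul, Pi.smul_apply, smul_eq_mul, map_mul, mul_assoc, inner_smul_left]
      rw [integral_const_mul, ihb]
  have hnorm : ∀ s ∈ Submodule.span ℂ A, eLpNorm (F s) 2 μ = ENNReal.ofReal ‖s‖ := by
    intro s hs
    refine eLpNorm_two_eq (hS s hs) (norm_nonneg s) ?_
    rw [hS2 s hs s hs, inner_self_eq_norm_sq_to_K]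
    rfl
  have hfatou : ∀ t, ∀ s : ℕ → H, (∀ m, s m ∈ Submodule.span ℂ A) → Tendsto s atTop (𝓝 t) →
      (∀ x, Tendsto (fun m => F (s m) x) atTop (𝓝 (F t x))) →
      ∀ m, eLpNorm (F t - F (s m)) 2 μ ≤ ENNReal.ofReal ‖t - s m‖ := by
    intro t s hs hst hsF m
    have h1 := Lp.eLpNorm_lim_le_liminf_eLpNorm (μ := μ) (p := 2)
      (f := fun l => F (s l) - F (s m))
      (fun l => ((hS _ (hs l)).sub (hS _ (hs m))).1) (F t - F (s m))
      (Eventually.of_forall fun x => (hsF x).sub_const _)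
    refine h1.trans (le_of_eq ?_)
    have h2 : ∀ l, eLpNorm (F (s l) - F (s m)) 2 μ = ENNReal.ofReal ‖s l - s m‖ := fun l => by
      rw [← map_sub, hnorm _ (Submodule.sub_mem _ (hs l) (hs m))]
    simp only [h2]
    exact (ENNReal.tendsto_ofReal ((hst.sub_const (s m)).norm)).liminf_eq
  have hM : ∀ t, MemLp (F t) 2 μ := by
    intro t
    obtain ⟨s, hs, hst, hsF⟩ := happ t
    have h1 : AEStronglyMeasurable (F t) μ :=
      aestronglyMeasurable_of_tendsto_ae atTop (fun m => (hS _ (hs m)).1)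
        (Eventually.of_forall hsF)
    have h2 : MemLp (F t - F (s 0)) 2 μ :=
      ⟨h1.sub (hS _ (hs 0)).1, (hfatou t s hs hst hsF 0).trans_lt ENNReal.ofReal_lt_top⟩
    simpa using h2.add (hS _ (hs 0))
  refine ⟨hM, fun t t' => ?_⟩
  have hlim : ∀ t, ∀ s : ℕ → H, (∀ m, s m ∈ Submodule.span ℂ A) → Tendsto s atTop (𝓝 t) →
      (∀ x, Tendsto (fun m => F (s m) x) atTop (𝓝 (F t x))) →
      Tendsto (fun m => (hM (s m)).toLp (F (s m))) atTop (𝓝 ((hM t).toLp (F t))) := by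
    intro t s hs hst hsF
    rw [Lp.tendsto_Lp_iff_tendsto_eLpNorm'']
    have h1 : Tendsto (fun m => ENNReal.ofReal ‖t - s m‖) atTop (𝓝 0) := by
      have h2 := ENNReal.tendsto_ofReal ((hst.const_sub t).norm)
      simpa using h2
    refine tendsto_of_tendsto_of_tendsto_of_le_of_le tendsto_const_nhds h1 (fun _ => zero_le)
      fun m => ?_
    change eLpNorm (F (s m) - F t) 2 μ ≤ _
    rw [← neg_sub, eLpNorm_neg]
    exact hfatou t s hs hst hsF m
  obtain ⟨s, hs, hst, hsF⟩ := happ t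
  obtain ⟨s', hs', hst', hsF'⟩ := happ t'
  have h1 := (hlim t s hs hst hsF).inner (𝕜 := ℂ) (hlim t' s' hs' hst' hsF')
  have h2 := hst.inner (𝕜 := ℂ) hst'
  simp only [inner_toLp, hS2 _ (hs _) _ (hs' _)] at h1
  exact tendsto_nhds_unique h1 h2

end Extension

/-- Lebesgue measure on `ℂⁿ` divided by `πⁿ`. -/
def normVolume (n : ℕ) : Measure (Fin n → ℂ) := ENNReal.ofReal ((Real.pi ^ n)⁻¹) • volume

lemma integral_normVolume {n : ℕ} (f : (Fin n → ℂ) → ℂ) :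
    ∫ ζ, f ζ ∂normVolume n = ((Real.pi ^ n)⁻¹ : ℝ) * ∫ ζ, f ζ := by
  rw [normVolume, integral_smul_measure, ENNReal.toReal_ofReal (by have := Real.pi_pos; positivity),
    Complex.real_smul]

lemma bellAmp_coherent {n : ℕ} (a b ζ : Fin n → ℂ) :
    bellAmp n (coherent a ⊗ₜ coherent b) ζ = Complex.exp (∑ i, (-(ζ i * conj (ζ i)) / 2
      - a i * conj (a i) / 2 - b i * conj (b i) / 2 + a i * b i
      - a i * ζ i + b i * conj (ζ i))) := by
  rw [bellAmp_tmul, J_coherent, ← inner_conj_symm, inner_coherent, D_fn, coherent_fn,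
    ← Complex.exp_add, ← Complex.exp_add, ← Complex.exp_conj]
  simp only [sum_norm_sq_eq]
  congr 1
  rw [← sub_eq_zero]
  simp only [neg_div, Finset.sum_div, ← Finset.sum_neg_distrib, map_sum,
    ← Finset.sum_add_distrib, ← Finset.sum_sub_distrib]
  refine Finset.sum_eq_zero fun i _ => ?_
  simp only [Pi.sub_apply, Pi.star_apply, RCLike.star_def, Complex.conj_conj, map_add, map_neg,
    map_sub, map_mul, map_div₀, map_ofNat]
  ring

/-- The product of two coherent amplitudes is, up to a constant, the integrand of the inner
product of two coherent states. -/
lemma conj_bellAmp_mul_bellAmp {n : ℕ} (a b a' b' ζ : Fin n → ℂ) :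
    conj (bellAmp n (coherent a ⊗ₜ coherent b) ζ) * bellAmp n (coherent a' ⊗ₜ coherent b') ζ
      = inner ℂ (coherent a ⊗ₜ[ℂ] coherent b) (coherent a' ⊗ₜ[ℂ] coherent b') *
        (inner ℂ (coherent (star b' - a)) (coherent (star b - a')))⁻¹ *
        (conj ((coherent (star b' - a)).fn ζ) * (coherent (star b - a')).fn ζ *
          (weight ζ : ℂ)) := by
  rw [TensorProduct.inner_tmul, inner_coherent_coherent, inner_coherent_coherent,
    inner_coherent_coherent, bellAmp_coherent, bellAmp_coherent, coherent_fn, coherent_fn, weight,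
    Complex.ofReal_exp, ← Complex.exp_conj, ← Complex.exp_conj, ← Complex.exp_neg]
  simp only [← Complex.exp_add]
  congr 1
  rw [Complex.ofReal_neg]
  simp only [sum_norm_sq_eq]
  rw [← sub_eq_zero]
  simp only [neg_div, Finset.sum_div, ← Finset.sum_neg_distrib, map_sum, map_add, map_neg,
    ← Finset.sum_add_distrib, ← Finset.sum_sub_distrib]
  refine Finset.sum_eq_zero fun i _ => ?_
  simp only [Pi.sub_apply, Pi.star_apply, RCLike.star_def, Complex.conj_conj, map_add, map_neg,
    map_sub, map_mul, map_div₀, map_ofNat]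
  ring

lemma inner_coherent_ne_zero {n : ℕ} (a b : Fin n → ℂ) :
    inner ℂ (coherent a) (coherent b) ≠ (0 : ℂ) := by
  rw [inner_coherent_coherent]; exact Complex.exp_ne_zero _

lemma memLp_bellAmp_coherent {n : ℕ} (a b : Fin n → ℂ) :
    MemLp (bellAmp n (coherent a ⊗ₜ coherent b)) 2 (normVolume n) := by
  have hc : Continuous (bellAmp n (coherent a ⊗ₜ coherent b)) := by
    have h : bellAmp n (coherent a ⊗ₜ coherent b) = _ := funext (bellAmp_coherent a b)
    rw [h]
    fun_prop
  rw [memLp_two_iff_integrable_sq_norm hc.aestronglyMeasurable]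
  have h : Integrable (fun ζ => conj (bellAmp n (coherent a ⊗ₜ coherent b) ζ) *
      bellAmp n (coherent a ⊗ₜ coherent b) ζ) (normVolume n) := by
    simp only [conj_bellAmp_mul_bellAmp]
    exact ((Fock.integrable_inner _ _).smul_measure ENNReal.ofReal_ne_top).const_mul _
  refine h.norm.congr (Eventually.of_forall fun ζ => ?_)
  simp only [norm_mul, RCLike.norm_conj]
  ring

/-- The orthogonality relations of the displacement operators: the Bell amplitude is an isometry
into `L²(π⁻ⁿ d²ⁿζ)`. -/
lemma memLp_and_integral_bellAmp (n : ℕ) :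
    (∀ t, MemLp (bellAmp n t) 2 (normVolume n)) ∧
      ∀ t t', ∫ ζ, conj (bellAmp n t ζ) * bellAmp n t' ζ ∂normVolume n = inner ℂ t t' := by
  refine memLp_and_integral_eq_inner_of_approx (bellAmp n)
    (Set.range fun p : (Fin n → ℂ) × (Fin n → ℂ) => coherent p.1 ⊗ₜ[ℂ] coherent p.2) ?_ ?_ ?_
  · rintro _ ⟨⟨a, b⟩, rfl⟩
    exact memLp_bellAmp_coherent a b
  · rintro _ ⟨⟨a, b⟩, rfl⟩ _ ⟨⟨a', b'⟩, rfl⟩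
    simp only [conj_bellAmp_mul_bellAmp, integral_const_mul]
    rw [integral_normVolume, ← fockInner, ← inner_eq_fockInner, mul_assoc,
      inv_mul_cancel₀ (inner_coherent_ne_zero _ _), mul_one]
  · intro t
    set S := Submodule.span ℂ (Set.range fun p : (Fin n → ℂ) × (Fin n → ℂ) =>
      coherent p.1 ⊗ₜ[ℂ] coherent p.2) with hS
    have hmem : ∀ f ∈ Submodule.span ℂ (Set.range (coherent (n := n))),
        ∀ g ∈ Submodule.span ℂ (Set.range (coherent (n := n))), f ⊗ₜ[ℂ] g ∈ S := by
      intro f hf g hg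
      have h := Submodule.apply_mem_map₂ (TensorProduct.mk ℂ (Fock n) (Fock n)) hf hg
      rw [Submodule.map₂_span_span] at h
      refine Submodule.span_mono ?_ h
      rintro _ ⟨_, ⟨a, rfl⟩, _, ⟨b, rfl⟩, rfl⟩
      exact ⟨(a, b), rfl⟩
    have hseq : ∀ f : Fock n, ∃ s : ℕ → Fock n,
        (∀ m, s m ∈ Submodule.span ℂ (Set.range (coherent (n := n)))) ∧
          Tendsto s atTop (𝓝 f) := fun f =>
      mem_closure_iff_seq_limit.1 ((dense_span_coherent n).closure_eq ▸ Set.mem_univ f)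
    induction t using TensorProduct.induction_on with
    | zero => exact ⟨fun _ => 0, fun _ => Submodule.zero_mem _, tendsto_const_nhds,
        fun _ => tendsto_const_nhds⟩
    | tmul f g =>
      obtain ⟨s, hs, hsf⟩ := hseq f
      obtain ⟨r, hr, hrg⟩ := hseq g
      refine ⟨fun m => s m ⊗ₜ r m, fun m => hmem _ (hs m) _ (hr m), ?_,
        tendsto_bellAmp_tmul hsf hrg⟩
      have h : Continuous fun p : Fock n × Fock n => p.1 ⊗ₜ[ℂ] p.2 := by fun_prop
      exact Tendsto.comp (g := fun p : Fock n × Fock n => p.1 ⊗ₜ[ℂ] p.2) (h.tendsto (f, g))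
        (hsf.prodMk_nhds hrg)
    | add t t' ht ht' =>
      obtain ⟨s, hs, hst, hsF⟩ := ht
      obtain ⟨r, hr, hrt, hrF⟩ := ht'
      refine ⟨fun m => s m + r m, fun m => Submodule.add_mem _ (hs m) (hr m), hst.add hrt,
        fun ζ => ?_⟩
      simp only [map_add, Pi.add_apply]
      exact (hsF ζ).add (hrF ζ)

/-! ### States as mixtures of vectors -/

/-- The operator `T` is the weakly convergent sum `∑ⱼ |φⱼ⟩⟨φⱼ|`, where `∑ⱼ ‖φⱼ‖²` converges. -/
structure IsMixture {n : ℕ} {ι : Type*} (T : Fock n →L[ℂ] Fock n) (φ : ι → Fock n) : Prop where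
  summable : Summable fun j => ‖φ j‖ ^ 2
  hasSum : ∀ f g, HasSum (fun j => inner ℂ f (φ j) * inner ℂ (φ j) g) (inner ℂ f (T g))

lemma hasSum_norm_inner_sq {n : ℕ} (x : Fock n) :
    HasSum (fun k => ‖inner ℂ (numberState k) x‖ ^ 2) (‖x‖ ^ 2) := by
  have h := (numberBasis n).hasSum_inner_mul_inner x x
  simp only [numberBasis_apply, inner_self_eq_norm_sq_to_K] at h
  have h2 : ∀ k, inner ℂ x (numberState k) * inner ℂ (numberState k) x
      = ((‖inner ℂ (numberState k) x‖ ^ 2 : ℝ) : ℂ) := fun k => by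
    rw [← inner_conj_symm x, RCLike.conj_mul]
    norm_cast
  simp only [h2] at h
  have h3 : ((‖x‖ ^ 2 : ℝ) : ℂ) = (RCLike.ofReal ‖x‖ : ℂ) ^ 2 := by push_cast; rfl
  rw [← h3] at h
  exact Complex.hasSum_ofReal.1 h

lemma exists_symmetric_sqrt {H : Type*} [NormedAddCommGroup H] [InnerProductSpace ℂ H]
    [CompleteSpace H] {T : H →L[ℂ] H} (hT : T.IsPositive) :
    ∃ S : H →L[ℂ] H, (∀ x y, inner ℂ (S x) y = (inner ℂ x (S y) : ℂ)) ∧ ∀ x, T x = S (S x) := by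
  have h0 : 0 ≤ T := (ContinuousLinearMap.nonneg_iff_isPositive _).2 hT
  have hSS : CFC.sqrt T * CFC.sqrt T = T := CFC.sqrt_mul_sqrt_self _ h0
  have hpos : (CFC.sqrt T).IsPositive :=
    (ContinuousLinearMap.nonneg_iff_isPositive _).1 (CFC.sqrt_nonneg _)
  exact ⟨CFC.sqrt T, hpos.inner_left_eq_inner_right, fun x => (DFunLike.congr_fun hSS x).symm⟩

/-- The square root `S` of a state resolves it into the vectors `S|k⟩`. -/
lemma QState.exists_isMixture {n : ℕ} (ρ : QState n) :
    ∃ φ : (Fin n → ℕ) → Fock n, IsMixture ρ.op φ ∧ HasSum (fun j => ‖φ j‖ ^ 2) 1 := by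
  obtain ⟨S, hsymm, happ⟩ := exists_symmetric_sqrt ρ.isPositive
  have hn : HasSum (fun j => ‖S (numberState j)‖ ^ 2) 1 := by
    have h := ρ.trace_eq_one
    have h2 : ∀ k, inner ℂ (numberState k) (ρ.op (numberState k))
        = ((‖S (numberState k)‖ ^ 2 : ℝ) : ℂ) := fun k => by
      rw [happ, ← hsymm, inner_self_eq_norm_sq_to_K]
      push_cast
      rfl
    simp only [h2] at h
    exact Complex.hasSum_ofReal.1 (by simpa using h)
  refine ⟨fun j => S (numberState j), ⟨hn.summable, fun f g => ?_⟩, hn⟩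
  have h := (numberBasis n).hasSum_inner_mul_inner (S f) (S g)
  simp only [numberBasis_apply] at h
  rw [happ, ← hsymm]
  simpa only [hsymm] using h

/-- The trace of `T A` in the number basis, for a mixture `T` and an operator `A` with adjoint `B`,
is the mixture of expectation values of `A`. -/
lemma IsMixture.hasSum_trace {n : ℕ} {ι : Type*} {T : Fock n →L[ℂ] Fock n} {φ : ι → Fock n}
    (hT : IsMixture T φ) (A B : Fock n →L[ℂ] Fock n)
    (hAB : ∀ x y, inner ℂ x (A y) = inner ℂ (B x) y) :
    ∃ s, HasSum (fun k => inner ℂ (numberState k) (T (A (numberState k)))) s ∧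
      HasSum (fun j => inner ℂ (φ j) (A (φ j))) s := by
  have hsq : ∀ x : ι → Fock n, Summable (fun j => ‖x j‖ ^ 2) →
      Summable fun p : ι × (Fin n → ℕ) => ‖inner ℂ (numberState p.2) (x p.1)‖ ^ 2 := by
    intro x hx
    rw [summable_prod_of_nonneg fun p => by positivity]
    refine ⟨fun j => (hasSum_norm_inner_sq (x j)).summable, ?_⟩
    simpa only [(hasSum_norm_inner_sq _).tsum_eq] using hx
  have hB : Summable fun j => ‖B (φ j)‖ ^ 2 := by
    refine Summable.of_nonneg_of_le (fun j => by positivity) (fun j => ?_)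
      (hT.summable.mul_left (‖B‖ ^ 2))
    rw [← mul_pow]
    exact pow_le_pow_left₀ (norm_nonneg _) (B.le_opNorm _) 2
  have hu : Summable fun p : ι × (Fin n → ℕ) =>
      inner ℂ (numberState p.2) (φ p.1) * inner ℂ (φ p.1) (A (numberState p.2)) := by
    refine Summable.of_norm_bounded ((hsq φ hT.summable).add (hsq (fun j => B (φ j)) hB))
      fun p => ?_
    rw [norm_mul, hAB, norm_inner_symm (B _)]
    nlinarith [sq_nonneg (‖inner ℂ (numberState p.2) (φ p.1)‖ -
      ‖inner ℂ (numberState p.2) (B (φ p.1))‖), norm_nonneg (inner ℂ (numberState p.2) (φ p.1)),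
      norm_nonneg (inner ℂ (numberState p.2) (B (φ p.1)))]
  obtain ⟨s, hs⟩ := hu
  refine ⟨s, ?_, ?_⟩
  · refine HasSum.prod_fiberwise ((Equiv.prodComm _ _).hasSum_iff.2 hs) fun k => ?_
    exact hT.hasSum (numberState k) (A (numberState k))
  · refine hs.prod_fiberwise fun j => ?_
    have h := (numberBasis n).hasSum_inner_mul_inner (B (φ j)) (φ j)
    simp only [numberBasis_apply] at h
    simp only [hAB]
    simpa only [mul_comm] using h

lemma QState.hasSum_χ {n : ℕ} {ι : Type*} (ρ : QState n) {φ : ι → Fock n}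
    (hφ : IsMixture ρ.op φ) (α : Fin n → ℂ) :
    HasSum (fun j => inner ℂ (φ j) (D α (φ j))) (ρ.χ α) := by
  obtain ⟨s, hs1, hs2⟩ := hφ.hasSum_trace (D α : Fock n →L[ℂ] Fock n)
    (D (-α) : Fock n →L[ℂ] Fock n) (fun x y => by
      change inner ℂ x (D α y) = inner ℂ (D (-α) x) y
      rw [inner_D_left, neg_neg])
  have h : ρ.χ α = s := hs1.tsum_eq
  rw [h]
  exact hs2

/-! ### The reflected state -/

/-- The conjugate `W T W⁻¹` of an operator by an antiunitary operator. -/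
def antiConj {n : ℕ} (W : Fock n ≃ₗᵢ⋆[ℂ] Fock n) (T : Fock n →L[ℂ] Fock n) :
    Fock n →L[ℂ] Fock n :=
  (W.toContinuousLinearEquiv : Fock n →L⋆[ℂ] Fock n).comp
    (T.comp (W.symm.toContinuousLinearEquiv : Fock n →L⋆[ℂ] Fock n))

@[simp] lemma antiConj_apply {n : ℕ} (W : Fock n ≃ₗᵢ⋆[ℂ] Fock n) (T : Fock n →L[ℂ] Fock n)
    (g : Fock n) : antiConj W T g = W (T (W.symm g)) := rfl

lemma inner_antiunitary_left {n : ℕ} {W : Fock n ≃ₗᵢ⋆[ℂ] Fock n}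
    (hW : ∀ f g, inner ℂ (W f) (W g) = (inner ℂ g f : ℂ)) (f g : Fock n) :
    inner ℂ (W f) g = (inner ℂ (W.symm g) f : ℂ) := by
  rw [← hW f (W.symm g), LinearIsometryEquiv.apply_symm_apply]

lemma inner_antiunitary_right {n : ℕ} {W : Fock n ≃ₗᵢ⋆[ℂ] Fock n}
    (hW : ∀ f g, inner ℂ (W f) (W g) = (inner ℂ g f : ℂ)) (f g : Fock n) :
    inner ℂ f (W g) = (inner ℂ g (W.symm f) : ℂ) := by
  rw [← hW (W.symm f) g, LinearIsometryEquiv.apply_symm_apply]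

lemma IsMixture.antiConj {n : ℕ} {ι : Type*} {T : Fock n →L[ℂ] Fock n} {φ : ι → Fock n}
    (hT : IsMixture T φ) {W : Fock n ≃ₗᵢ⋆[ℂ] Fock n}
    (hW : ∀ f g, inner ℂ (W f) (W g) = (inner ℂ g f : ℂ)) :
    IsMixture (antiConj W T) fun j => W (φ j) := by
  refine ⟨by simpa using hT.summable, fun f g => ?_⟩
  simp only [antiConj_apply, inner_antiunitary_left hW, inner_antiunitary_right hW]
  have h := (hT.hasSum (W.symm f) (W.symm g)).star
  simp only [RCLike.star_def, map_mul, inner_conj_symm] at h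
  exact h

lemma isPositive_antiConj {n : ℕ} {T : Fock n →L[ℂ] Fock n} (hT : T.IsPositive)
    {W : Fock n ≃ₗᵢ⋆[ℂ] Fock n} (hW : ∀ f g, inner ℂ (W f) (W g) = (inner ℂ g f : ℂ)) :
    (antiConj W T).IsPositive := by
  refine ContinuousLinearMap.isPositive_def.2 ⟨fun f g => ?_, fun f => ?_⟩
  · change inner ℂ (W (T (W.symm f))) g = inner ℂ f (W (T (W.symm g)))
    rw [inner_antiunitary_left hW, inner_antiunitary_right hW, hT.inner_left_eq_inner_right]
  · rw [ContinuousLinearMap.reApplyInnerSelf_apply, antiConj_apply,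
      inner_antiunitary_left hW]
    exact hT.re_inner_nonneg_right _

/-- The antiunitary `J 𝒱`, where `𝒱` is the passive unitary of the matrix `-U`. -/
def reflection {n : ℕ} (U : Matrix.unitaryGroup (Fin n) ℂ) : Fock n ≃ₗᵢ⋆[ℂ] Fock n :=
  (passive (-U)).trans (J n)

lemma reflection_apply {n : ℕ} (U : Matrix.unitaryGroup (Fin n) ℂ) (f : Fock n) :
    reflection U f = J n (passive (-U) f) := rfl

lemma inner_reflection {n : ℕ} (U : Matrix.unitaryGroup (Fin n) ℂ) (f g : Fock n) :
    inner ℂ (reflection U f) (reflection U g) = (inner ℂ g f : ℂ) := by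
  rw [reflection_apply, reflection_apply, inner_J_J, LinearIsometryEquiv.inner_map_map]

lemma inner_reflection_D {n : ℕ} (U : Matrix.unitaryGroup (Fin n) ℂ) (α : Fin n → ℂ)
    (f : Fock n) : inner ℂ (reflection U f) (D α (reflection U f))
      = (inner ℂ f (D (U.1.transpose.mulVec (star α)) f) : ℂ) := by
  have h1 : D α (reflection U f) = J n (D (star α) (passive (-U) f)) := by
    rw [J_D, star_star, reflection_apply]
  have h2 : (-U : Matrix.unitaryGroup (Fin n) ℂ).1 = -U.1 := rfl
  rw [h1, reflection_apply, inner_J_J, ← (passive (-U)).symm.inner_map_map,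
    LinearIsometryEquiv.symm_apply_apply, passive_symm_D_passive, inner_D_left, h2,
    Matrix.transpose_neg, Matrix.neg_mulVec, neg_neg]

/-- The reflected state exists: it is the conjugate of the state by an antiunitary operator. -/
lemma exists_isReflected {n : ℕ} (U : Matrix.unitaryGroup (Fin n) ℂ) (hU : U.1.IsSymm)
    (ρ : QState n) : ∃ σ : QState n, IsReflected U ρ σ := by
  obtain ⟨φ, hφ, hφ1⟩ := ρ.exists_isMixture
  have hσ := hφ.antiConj (inner_reflection U)
  let σ : QState n :=
    { op := antiConj (reflection U) ρ.op
      isPositive := isPositive_antiConj ρ.isPositive (inner_reflection U)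
      trace_eq_one := by
        obtain ⟨s, hs1, hs2⟩ := hσ.hasSum_trace (.id ℂ _) (.id ℂ _) (fun _ _ => rfl)
        have h : s = 1 := by
          refine hs2.unique ?_
          have h3 : ∀ j, inner ℂ (reflection U (φ j))
              (ContinuousLinearMap.id ℂ (Fock n) (reflection U (φ j)))
              = ((‖φ j‖ ^ 2 : ℝ) : ℂ) := fun j => by
            rw [ContinuousLinearMap.id_apply, inner_self_eq_norm_sq_to_K,
              LinearIsometryEquiv.norm_map]
            push_cast
            rfl
          simp only [h3]
          simpa only [Complex.ofReal_one] using Complex.hasSum_ofReal.2 hφ1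
        rw [← h]
        exact hs1 }
  refine ⟨σ, fun α => ?_⟩
  have h1 := σ.hasSum_χ hσ α
  simp only [inner_reflection_D, hU.eq] at h1
  exact h1.unique (ρ.hasSum_χ hφ _)

/-! ### The outcome density -/

lemma IsMixture.passive {n : ℕ} {ι : Type*} {T : Fock n →L[ℂ] Fock n} {φ : ι → Fock n}
    (hT : IsMixture T φ) (U : Matrix.unitaryGroup (Fin n) ℂ) :
    IsMixture ((CVBell.passive U : Fock n →L[ℂ] Fock n) ∘L T ∘L
      ((CVBell.passive U).symm : Fock n →L[ℂ] Fock n)) fun j => CVBell.passive U (φ j) := by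
  refine ⟨by simpa using hT.summable, fun f g => ?_⟩
  have h1 : ∀ f g, inner ℂ (CVBell.passive U f) g
      = (inner ℂ f ((CVBell.passive U).symm g) : ℂ) := fun f g => by
    rw [← (CVBell.passive U).inner_map_map f, LinearIsometryEquiv.apply_symm_apply]
  have h2 : ∀ f g, inner ℂ f (CVBell.passive U g)
      = (inner ℂ ((CVBell.passive U).symm f) g : ℂ) := fun f g => by
    rw [← (CVBell.passive U).inner_map_map _ g, LinearIsometryEquiv.apply_symm_apply]
  have h := hT.hasSum ((CVBell.passive U).symm f) ((CVBell.passive U).symm g)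
  simp only [← h1, ← h2] at h
  exact h

lemma hasSum_complex_mul {ι κ : Type*} {f : ι → ℂ} {g : κ → ℂ} {a b : ℂ} (hf : HasSum f a)
    (hg : HasSum g b) : HasSum (fun p : ι × κ => f p.1 * g p.2) (a * b) := by
  have hs : Summable fun p : ι × κ => f p.1 * g p.2 :=
    summable_mul_of_summable_norm hf.summable.norm hg.summable.norm
  exact hf.mul hg hs

lemma IsMixture.hasSum_mapL {n : ℕ} {ι κ : Type*} {T S : Fock n →L[ℂ] Fock n} {φ : ι → Fock n}
    {ψ : κ → Fock n} (hT : IsMixture T φ) (hS : IsMixture S ψ) (t t' : Fock n ⊗[ℂ] Fock n) :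
    HasSum (fun p : ι × κ => inner ℂ t (φ p.1 ⊗ₜ[ℂ] ψ p.2) * inner ℂ (φ p.1 ⊗ₜ[ℂ] ψ p.2) t')
      (inner ℂ t (TensorProduct.mapL T S t')) := by
  induction t using TensorProduct.induction_on with
  | zero => simp
  | add t s ht hs =>
    simp only [inner_add_left, add_mul]
    exact ht.add hs
  | tmul f g =>
    induction t' using TensorProduct.induction_on with
    | zero => simp
    | add t s ht hs =>
      simp only [inner_add_right, mul_add, map_add]
      exact ht.add hs
    | tmul f' g' =>
      have h := hasSum_complex_mul (hT.hasSum f f') (hS.hasSum g g')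
      simp only [TensorProduct.inner_tmul, TensorProduct.mapL_apply, TensorProduct.map_tmul,
        ContinuousLinearMap.coe_coe]
      simpa only [mul_mul_mul_comm] using h

/-- The expectation of a bounded function under a density given as a series of nonnegative
integrable functions. -/
lemma integral_withDensity_tsum {X ι : Type*} [MeasurableSpace X] {μ : Measure X} [Countable ι]
    {w : ι → X → ℝ} {e : X → ℂ} {c : ℂ} (hw : ∀ i x, 0 ≤ w i x) (hsum : ∀ x, Summable (w · x))
    (hint : ∀ i, Integrable (w i) μ) (hints : Summable fun i => ∫ x, w i x ∂μ)
    (he : AEStronglyMeasurable e μ) (he1 : ∀ x, ‖e x‖ ≤ 1)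
    (hc : HasSum (fun i => ∫ x, (w i x : ℂ) * e x ∂μ) c) :
    ∫ x, e x ∂μ.withDensity (fun x => ∑' i, ENNReal.ofReal (w i x)) = c := by
  rw [integral_withDensity_eq_integral_toReal_smul₀
    (AEMeasurable.tsum fun i => (hint i).aemeasurable.ennreal_ofReal)
    (Eventually.of_forall fun x => by
      rw [← ENNReal.ofReal_tsum_of_nonneg (fun i => hw i x) (hsum x)]
      exact ENNReal.ofReal_lt_top)]
  have h1 : ∀ x, (∑' i, ENNReal.ofReal (w i x)).toReal • e x = ∑' i, (w i x : ℂ) * e x := by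
    intro x
    rw [← ENNReal.ofReal_tsum_of_nonneg (fun i => hw i x) (hsum x),
      ENNReal.toReal_ofReal (tsum_nonneg fun i => hw i x), Complex.real_smul,
      Complex.ofReal_tsum, tsum_mul_right]
  simp only [h1]
  have hi : ∀ i, Integrable (fun x => (w i x : ℂ) * e x) μ := fun i =>
    (hint i).ofReal.mul_bdd (c := 1) he (Eventually.of_forall he1)
  refine (hasSum_integral_of_summable_integral_norm hi ?_).unique hc
  refine hints.of_nonneg_of_le (fun i => integral_nonneg fun x => norm_nonneg _) fun i => ?_
  refine integral_mono (hi i).norm (hint i) fun x => ?_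
  simp only [norm_mul, Complex.norm_real, Real.norm_of_nonneg (hw i x)]
  exact mul_le_of_le_one_right (hw i x) (he1 x)

section Mixtures

variable {n : ℕ} {ι : Type*} {T S : Fock n →L[ℂ] Fock n} {φ ψ : ι → Fock n}

lemma summable_norm_sq_mul (hT : IsMixture T φ) (hS : IsMixture S ψ) :
    Summable fun p : ι × ι => ‖φ p.1‖ ^ 2 * ‖ψ p.2‖ ^ 2 :=
  hT.summable.mul_of_nonneg hS.summable (fun _ => by positivity) (fun _ => by positivity)

lemma norm_sq_bellAmp_le (f g : Fock n) (ζ : Fin n → ℂ) :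
    ‖bellAmp n (f ⊗ₜ g) ζ‖ ^ 2 ≤ ‖f‖ ^ 2 * ‖g‖ ^ 2 := by
  rw [← mul_pow]
  exact pow_le_pow_left₀ (norm_nonneg _) (norm_bellAmp_tmul_le f g ζ) 2

lemma bellDensityTrunc_mapL (hT : IsMixture T φ) (hS : IsMixture S ψ)
    (K : Finset (Fin n → ℕ)) (ζ : Fin n → ℂ) :
    bellDensityTrunc (TensorProduct.mapL T S) K ζ = (Real.pi ^ n)⁻¹ *
      ∑' p : ι × ι, ‖inner ℂ (bellVec K ζ) (φ p.1 ⊗ₜ[ℂ] ψ p.2)‖ ^ 2 := by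
  have h := hT.hasSum_mapL hS (bellVec K ζ) (bellVec K ζ)
  have h1 : ∀ p : ι × ι, inner ℂ (bellVec K ζ) (φ p.1 ⊗ₜ[ℂ] ψ p.2) *
      inner ℂ (φ p.1 ⊗ₜ[ℂ] ψ p.2) (bellVec K ζ)
      = ((‖inner ℂ (bellVec K ζ) (φ p.1 ⊗ₜ[ℂ] ψ p.2)‖ ^ 2 : ℝ) : ℂ) := fun p => by
    rw [← inner_conj_symm (φ p.1 ⊗ₜ[ℂ] ψ p.2), RCLike.mul_conj]
    norm_cast
  simp only [h1] at h
  have h2 := (Complex.hasSum_re h).tsum_eq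
  simp only [Complex.ofReal_re] at h2
  rw [bellDensityTrunc, h2]

/-- The truncated densities converge by dominated convergence, with bound `‖φⱼ‖² ‖ψₘ‖²`. -/
lemma tendsto_bellDensityTrunc (hT : IsMixture T φ) (hS : IsMixture S ψ) (ζ : Fin n → ℂ) :
    Tendsto (fun K => bellDensityTrunc (TensorProduct.mapL T S) K ζ) atTop
      (𝓝 ((Real.pi ^ n)⁻¹ * ∑' p : ι × ι, ‖bellAmp n (φ p.1 ⊗ₜ ψ p.2) ζ‖ ^ 2)) := by
  simp only [bellDensityTrunc_mapL hT hS]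
  refine Tendsto.const_mul _ (tendsto_tsum_of_dominated_convergence (summable_norm_sq_mul hT hS)
    (fun p => (tendsto_inner_bellVec ζ _ _).norm.pow 2) (Eventually.of_forall fun K p => ?_))
  rw [Real.norm_of_nonneg (by positivity), ← mul_pow]
  exact pow_le_pow_left₀ (norm_nonneg _) (norm_inner_bellVec_le K ζ _ _) 2

lemma bellDensity_mapL (hT : IsMixture T φ) (hS : IsMixture S ψ) (ζ : Fin n → ℂ) :
    bellDensity (TensorProduct.mapL T S) ζ
      = (Real.pi ^ n)⁻¹ * ∑' p : ι × ι, ‖bellAmp n (φ p.1 ⊗ₜ ψ p.2) ζ‖ ^ 2 :=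
  (tendsto_bellDensityTrunc hT hS ζ).limUnder_eq

lemma bellLaw_mapL (hT : IsMixture T φ) (hS : IsMixture S ψ) :
    bellLaw (TensorProduct.mapL T S) = (normVolume n).withDensity fun ζ =>
      ∑' p : ι × ι, ENNReal.ofReal (‖bellAmp n (φ p.1 ⊗ₜ ψ p.2) ζ‖ ^ 2) := by
  have hπ : (0 : ℝ) ≤ (Real.pi ^ n)⁻¹ := by have := Real.pi_pos; positivity
  rw [normVolume, withDensity_smul_measure, ← withDensity_smul' _ _ ENNReal.ofReal_ne_top, bellLaw]
  congr 1
  funext ζ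
  rw [bellDensity_mapL hT hS, ENNReal.ofReal_mul hπ, ENNReal.ofReal_tsum_of_nonneg
    (fun p => by positivity) ((summable_norm_sq_mul hT hS).of_nonneg_of_le
      (fun p => by positivity) fun p => norm_sq_bellAmp_le _ _ ζ)]
  rfl

lemma aemeasurable_bellAmp_sq (f g : Fock n) :
    AEMeasurable (fun ζ => ENNReal.ofReal (‖bellAmp n (f ⊗ₜ g) ζ‖ ^ 2)) (normVolume n) :=
  (((memLp_and_integral_bellAmp n).1 (f ⊗ₜ g)).1.norm.pow 2).aemeasurable.ennreal_ofReal

lemma integrable_bellAmp_sq (f g : Fock n) :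
    Integrable (fun ζ => ‖bellAmp n (f ⊗ₜ g) ζ‖ ^ 2) (normVolume n) :=
  have hM := (memLp_and_integral_bellAmp n).1 (f ⊗ₜ g)
  (memLp_two_iff_integrable_sq_norm hM.1).1 hM

lemma lintegral_bellAmp_sq (f g : Fock n) :
    ∫⁻ ζ, ENNReal.ofReal (‖bellAmp n (f ⊗ₜ g) ζ‖ ^ 2) ∂normVolume n
      = ENNReal.ofReal (‖f‖ ^ 2 * ‖g‖ ^ 2) := by
  obtain ⟨hM, hI⟩ := memLp_and_integral_bellAmp n
  rw [← ofReal_integral_eq_lintegral_ofReal (integrable_bellAmp_sq f g)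
    (Eventually.of_forall fun _ => by positivity)]
  congr 1
  have h2 := hI (f ⊗ₜ g) (f ⊗ₜ g)
  rw [TensorProduct.inner_tmul, inner_self_eq_norm_sq_to_K, inner_self_eq_norm_sq_to_K] at h2
  simp only [RCLike.conj_mul] at h2
  apply Complex.ofReal_injective
  rw [← integral_complex_ofReal]
  push_cast
  simpa [mul_pow] using h2

lemma isProbabilityMeasure_bellLaw [Countable ι] (hT : IsMixture T φ) (hS : IsMixture S ψ)
    (hφ : HasSum (fun j => ‖φ j‖ ^ 2) 1) (hψ : HasSum (fun j => ‖ψ j‖ ^ 2) 1) :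
    IsProbabilityMeasure (bellLaw (TensorProduct.mapL T S)) := by
  constructor
  rw [bellLaw_mapL hT hS, withDensity_apply _ MeasurableSet.univ, Measure.restrict_univ,
    lintegral_tsum fun p => aemeasurable_bellAmp_sq _ _]
  simp only [lintegral_bellAmp_sq]
  have hs := summable_norm_sq_mul hT hS
  rw [← ENNReal.ofReal_tsum_of_nonneg (fun p => by positivity) hs, (hφ.mul hψ hs).tsum_eq,
    one_mul, ENNReal.ofReal_one]

lemma integral_phase_mul_bellAmp_sq (α : Fin n → ℂ) (f g : Fock n) :
    ∫ ζ, ((‖bellAmp n (f ⊗ₜ g) ζ‖ ^ 2 : ℝ) : ℂ) *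
        Complex.exp (-(ζ ⬝ᵥ α - star ζ ⬝ᵥ star α)) ∂normVolume n
      = inner ℂ f (D α f) * inner ℂ g (D (star α) g) := by
  rw [← TensorProduct.inner_tmul, ← (memLp_and_integral_bellAmp n).2]
  congr 1
  funext ζ
  rw [bellAmp_D_tmul_D, mul_left_comm, RCLike.conj_mul, mul_comm]
  push_cast
  rfl

lemma norm_phase (ζ α : Fin n → ℂ) :
    ‖Complex.exp (-(ζ ⬝ᵥ α - star ζ ⬝ᵥ star α))‖ = 1 := by
  have h : star ζ ⬝ᵥ star α = conj (ζ ⬝ᵥ α) := by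
    simp [dotProduct, map_sum]
  rw [Complex.norm_exp, h]
  simp

lemma continuous_phase (α : Fin n → ℂ) :
    Continuous fun ζ : Fin n → ℂ => Complex.exp (-(ζ ⬝ᵥ α - star ζ ⬝ᵥ star α)) := by
  unfold dotProduct
  fun_prop

lemma integral_bellAmp_sq (f g : Fock n) :
    ∫ ζ, ‖bellAmp n (f ⊗ₜ g) ζ‖ ^ 2 ∂normVolume n = ‖f‖ ^ 2 * ‖g‖ ^ 2 := by
  have h := lintegral_bellAmp_sq f g
  rw [← ofReal_integral_eq_lintegral_ofReal (integrable_bellAmp_sq f g)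
    (Eventually.of_forall fun _ => by positivity)] at h
  exact (ENNReal.ofReal_eq_ofReal_iff (integral_nonneg fun _ => by positivity)
    (by positivity)).1 h

/-- The characteristic function of the outcome law is the product of the characteristic functions
of the two inputs. -/
lemma integral_phase_bellLaw [Countable ι] (hT : IsMixture T φ) (hS : IsMixture S ψ)
    (α : Fin n → ℂ) {a b : ℂ} (ha : HasSum (fun j => inner ℂ (φ j) (D α (φ j))) a)
    (hb : HasSum (fun j => inner ℂ (ψ j) (D (star α) (ψ j))) b) :
    ∫ ζ, Complex.exp (-(ζ ⬝ᵥ α - star ζ ⬝ᵥ star α)) ∂bellLaw (TensorProduct.mapL T S)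
      = a * b := by
  have hs := summable_norm_sq_mul hT hS
  rw [bellLaw_mapL hT hS]
  refine integral_withDensity_tsum (fun p ζ => by positivity)
    (fun ζ => hs.of_nonneg_of_le (fun p => by positivity) fun p => norm_sq_bellAmp_le _ _ ζ)
    (fun p => integrable_bellAmp_sq _ _) (by simpa only [integral_bellAmp_sq] using hs)
    (continuous_phase α).aestronglyMeasurable (fun ζ => (norm_phase ζ α).le) ?_
  simp only [integral_phase_mul_bellAmp_sq]
  have h := hasSum_complex_mul ha hb
  exact h

end Mixtures

/-- The second input `𝒰 σ 𝒰†` has the same expectation of `D(α*)` as `ρ` has of `D(α)`, because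
`U (Uᵀ α*)* = α`. Hence the outcome law has characteristic function `χ_ρ²`. -/
lemma bellInput_law {n : ℕ} (U : Matrix.unitaryGroup (Fin n) ℂ)
    (ρ σ : QState n) (hσ : IsReflected U ρ σ) :
    (∀ ζ : Fin n → ℂ, Tendsto (fun K => bellDensityTrunc (bellInput U ρ σ) K ζ) atTop
      (𝓝 (bellDensity (bellInput U ρ σ) ζ))) ∧
    IsProbabilityMeasure (bellLaw (bellInput U ρ σ)) ∧
    ∀ α, ∫ ζ, Complex.exp (-(ζ ⬝ᵥ α - star ζ ⬝ᵥ star α)) ∂bellLaw (bellInput U ρ σ)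
      = ρ.χ α ^ 2 := by
  obtain ⟨φ, hφ, hφ1⟩ := ρ.exists_isMixture
  obtain ⟨s, hs, hs1⟩ := σ.exists_isMixture
  have hψ := hs.passive U
  refine ⟨fun ζ => ?_, ?_, fun α => ?_⟩
  · have h := tendsto_bellDensityTrunc hφ hψ ζ
    rw [← bellDensity_mapL hφ hψ ζ] at h
    exact h
  · exact isProbabilityMeasure_bellLaw hφ hψ hφ1 (by simpa using hs1)
  · have h1 : ∀ j, inner ℂ (passive U (s j)) (D (star α) (passive U (s j)))
        = (inner ℂ (s j) (D (U.1.transpose.mulVec (star α)) (s j)) : ℂ) := fun j => by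
      rw [← passive_symm_D_passive, ← (passive U).inner_map_map (s j),
        LinearIsometryEquiv.apply_symm_apply]
    have h2 : σ.χ (U.1.transpose.mulVec (star α)) = ρ.χ α := by
      rw [hσ, Matrix.mulVec_transpose, Matrix.star_vecMul, star_star]
      have h3 : Matrix.conjTranspose U.1 = star U.1 := rfl
      rw [h3, Matrix.mulVec_mulVec, Matrix.mem_unitaryGroup_iff.1 U.2, Matrix.one_mulVec]
    have h4 : HasSum (fun j => inner ℂ (passive U (s j)) (D (star α) (passive U (s j))))
        (ρ.χ α) := by
      simp only [h1, ← h2]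
      exact σ.hasSum_χ hs _
    rw [sq]
    exact integral_phase_bellLaw hφ hψ α (ρ.hasSum_χ hφ α) h4

/-! ### Concentration of the empirical averages -/

section Concentration

open ProbabilityTheory

variable {X : Type*} [MeasurableSpace X] {ν : Measure X} [IsProbabilityMeasure ν] {N : ℕ}

/-- Hoeffding's inequality for independent copies of a variable with values in `[-1, 1]`. -/
lemma measureReal_le_sum_sub_integral {f : X → ℝ} (hf : Measurable f) (hf1 : ∀ x, |f x| ≤ 1)
    (hN : 0 < N) {η : ℝ} (hη : 0 ≤ η) :
    (Measure.pi fun _ : Fin N => ν).real {ω | N * η ≤ ∑ j, (f (ω j) - ∫ x, f x ∂ν)}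
      ≤ Real.exp (-(N * η ^ 2) / 2) := by
  have hsub : ∀ j ∈ (Finset.univ : Finset (Fin N)),
      HasSubgaussianMGF (fun ω : Fin N → X => f (ω j) - ∫ x, f x ∂ν) 1
        (Measure.pi fun _ : Fin N => ν) := by
    intro j _
    have h := hasSubgaussianMGF_of_mem_Icc (μ := Measure.pi fun _ : Fin N => ν)
      (X := fun ω => f (ω j)) (a := -1) (b := 1) (hf.comp (measurable_pi_apply j)).aemeasurable
      (Eventually.of_forall fun ω => abs_le.1 (hf1 (ω j)))
    have h1 : ∫ ω, f (ω j) ∂(Measure.pi fun _ : Fin N => ν) = ∫ x, f x ∂ν :=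
      integral_comp_eval (μ := fun _ : Fin N => ν) hf.aestronglyMeasurable
    have h2 : (‖(1 : ℝ) - -1‖₊ / 2) ^ 2 = 1 := by
      ext
      norm_num
    rwa [h1, h2] at h
  have hind : iIndepFun (fun (j : Fin N) (ω : Fin N → X) => f (ω j) - ∫ x, f x ∂ν)
      (Measure.pi fun _ : Fin N => ν) :=
    iIndepFun_pi (μ := fun _ : Fin N => ν) (X := fun _ x => f x - ∫ x, f x ∂ν)
      fun _ => (hf.sub_const _).aemeasurable
  refine (HasSubgaussianMGF.measure_sum_ge_le_of_iIndepFun hind hsub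
    (by positivity : 0 ≤ N * η)).trans (le_of_eq ?_)
  have hN' : (N : ℝ) ≠ 0 := by positivity
  congr 1
  simp only [Finset.sum_const, Finset.card_univ, Fintype.card_fin, nsmul_eq_mul,
    mul_one, NNReal.coe_natCast]
  field_simp

lemma measureReal_le_abs_sum_sub_integral {f : X → ℝ} (hf : Measurable f) (hf1 : ∀ x, |f x| ≤ 1)
    (hN : 0 < N) {η : ℝ} (hη : 0 ≤ η) :
    (Measure.pi fun _ : Fin N => ν).real {ω | N * η ≤ |∑ j, (f (ω j) - ∫ x, f x ∂ν)|}
      ≤ 2 * Real.exp (-(N * η ^ 2) / 2) := by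
  have h1 := measureReal_le_sum_sub_integral (ν := ν) hf hf1 hN hη
  have h2 := measureReal_le_sum_sub_integral (ν := ν) hf.neg (fun x => by simpa using hf1 x) hN hη
  have hset : {ω : Fin N → X | N * η ≤ |∑ j, (f (ω j) - ∫ x, f x ∂ν)|} ⊆
      {ω | N * η ≤ ∑ j, (f (ω j) - ∫ x, f x ∂ν)} ∪
        {ω | N * η ≤ ∑ j, ((-f) (ω j) - ∫ x, (-f) x ∂ν)} := by
    intro ω hω
    rcases le_abs.1 (show N * η ≤ _ from hω) with h | h
    · exact Or.inl h
    · refine Or.inr (h.trans (le_of_eq ?_))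
      simp only [Pi.neg_apply, integral_neg, ← Finset.sum_neg_distrib]
      exact Finset.sum_congr rfl fun j _ => by ring
  calc _ ≤ _ := measureReal_mono hset
    _ ≤ _ := measureReal_union_le _ _
    _ ≤ _ := by linarith

/-- Hoeffding's inequality for complex variables of modulus at most one, from the inequality for
the real and the imaginary part. -/
lemma measureReal_lt_norm_average_sub {e : X → ℂ} (he : Measurable e) (he1 : ∀ x, ‖e x‖ ≤ 1)
    (hN : 0 < N) {ε : ℝ} (hε : 0 ≤ ε) :
    (Measure.pi fun _ : Fin N => ν).real
        {ω | ε < ‖(N : ℂ)⁻¹ * ∑ j, e (ω j) - ∫ x, e x ∂ν‖}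
      ≤ 4 * Real.exp (-(N * ε ^ 2) / 8) := by
  have hN' : (0 : ℝ) < N := by exact_mod_cast hN
  have hint : Integrable e ν := (integrable_const (1 : ℝ)).mono' he.aestronglyMeasurable
    (Eventually.of_forall he1)
  have hη : 0 ≤ ε / 2 := by linarith
  have h1 := measureReal_le_abs_sum_sub_integral (ν := ν) (Complex.measurable_re.comp he)
    (fun x => (Complex.abs_re_le_norm _).trans (he1 x)) hN hη
  have h2 := measureReal_le_abs_sum_sub_integral (ν := ν) (Complex.measurable_im.comp he)
    (fun x => (Complex.abs_im_le_norm _).trans (he1 x)) hN hη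
  have hre : ∫ x, (Complex.re ∘ e) x ∂ν = (∫ x, e x ∂ν).re := integral_re hint
  have him : ∫ x, (Complex.im ∘ e) x ∂ν = (∫ x, e x ∂ν).im := integral_im hint
  have hset : {ω : Fin N → X | ε < ‖(N : ℂ)⁻¹ * ∑ j, e (ω j) - ∫ x, e x ∂ν‖} ⊆
      {ω | N * (ε / 2) ≤ |∑ j, ((Complex.re ∘ e) (ω j) - ∫ x, (Complex.re ∘ e) x ∂ν)|} ∪
      {ω | N * (ε / 2) ≤ |∑ j, ((Complex.im ∘ e) (ω j) - ∫ x, (Complex.im ∘ e) x ∂ν)|} := by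
    intro ω hω
    by_contra hcon
    rw [hre, him] at hcon
    simp only [Set.mem_union, Set.mem_ofPred_eq, not_or, not_le, Function.comp_apply] at hcon hω
    have hS : (N : ℂ)⁻¹ * ∑ j, e (ω j) - ∫ x, e x ∂ν
        = (N : ℂ)⁻¹ * ∑ j, (e (ω j) - ∫ x, e x ∂ν) := by
      have : (N : ℂ) ≠ 0 := by exact_mod_cast hN.ne'
      simp only [Finset.sum_sub_distrib, Finset.sum_const, Finset.card_univ, Fintype.card_fin,
        nsmul_eq_mul]
      field_simp
    have hle := Complex.norm_le_abs_re_add_abs_im (∑ j, (e (ω j) - ∫ x, e x ∂ν))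
    simp only [Complex.re_sum, Complex.im_sum, Complex.sub_re, Complex.sub_im] at hle
    rw [hS, norm_mul, norm_inv, Complex.norm_natCast, lt_inv_mul_iff₀ hN'] at hω
    linarith [hcon.1, hcon.2]
  calc _ ≤ _ := measureReal_mono hset
    _ ≤ _ := measureReal_union_le _ _
    _ ≤ _ := add_le_add h1 h2
    _ = _ := by
      rw [show -(N * (ε / 2) ^ 2) / 2 = -(N * ε ^ 2) / 8 by ring]
      ring

/-- The union bound: `N ≥ 24 ε⁻² log (M / δ)` samples suffice for `M` averages, since then
`4 M exp (-N ε² / 8) ≤ 4 M (δ / M) ^ 3 ≤ δ`. -/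
lemma ofReal_le_measure_average {M : ℕ} {e : Fin M → X → ℂ} (he : ∀ i, Measurable (e i))
    (he1 : ∀ i x, ‖e i x‖ ≤ 1) {ε δ : ℝ} (hε : 0 < ε) (hδ : 0 < δ) (hδ1 : δ < 1)
    (hM : 2 * δ ≤ M) (hN : 24 * (ε ^ 2)⁻¹ * Real.log (M / δ) ≤ N) :
    ENNReal.ofReal (1 - δ) ≤ (Measure.pi fun _ : Fin N => ν)
      {ω | ∀ i, ‖(N : ℂ)⁻¹ * ∑ j, e i (ω j) - ∫ x, e i x ∂ν‖ ≤ ε} := by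
  set P := Measure.pi fun _ : Fin N => ν
  have hM0 : (0 : ℝ) < M := by linarith
  have hMδ : 2 ≤ (M : ℝ) / δ := (le_div_iff₀ hδ).2 hM
  have hlog : 0 < Real.log (M / δ) := Real.log_pos (by linarith)
  have hN0 : 0 < N := by
    have h : (0 : ℝ) < N := lt_of_lt_of_le (by positivity) hN
    exact_mod_cast h
  have hexp : Real.exp (-(N * ε ^ 2) / 8) ≤ (δ / M) ^ 3 := by
    have h1 : 3 * Real.log (M / δ) ≤ N * ε ^ 2 / 8 := by
      have h2 := mul_le_mul_of_nonneg_right hN (by positivity : 0 ≤ ε ^ 2)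
      have h3 : 24 * (ε ^ 2)⁻¹ * Real.log (M / δ) * ε ^ 2 = 24 * Real.log (M / δ) := by
        field_simp
      rw [h3] at h2
      linarith
    have h4 : (δ / M) ^ 3 = Real.exp (-(3 * Real.log (M / δ))) := by
      rw [← Real.log_rpow (by positivity), ← Real.log_inv, Real.exp_log (by positivity)]
      rw [Real.rpow_ofNat, ← inv_pow, inv_div]
    rw [h4]
    exact Real.exp_le_exp.2 (by linarith)
  have hunion : P.real {ω | ∃ i, ε < ‖(N : ℂ)⁻¹ * ∑ j, e i (ω j) - ∫ x, e i x ∂ν‖} ≤ δ := by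
    rw [Set.ofPred_exists]
    refine (measureReal_iUnion_fintype_le _).trans ?_
    refine (Finset.sum_le_sum fun i _ =>
      measureReal_lt_norm_average_sub (he i) (he1 i) hN0 hε.le).trans ?_
    rw [Finset.sum_const, Finset.card_univ, Fintype.card_fin, nsmul_eq_mul]
    have h5 : δ / M ≤ 1 / 2 := by
      rw [div_le_iff₀ hM0]; linarith
    have h6 : (0 : ℝ) ≤ δ / M := by positivity
    calc (M : ℝ) * (4 * Real.exp (-(N * ε ^ 2) / 8)) ≤ M * (4 * (δ / M) ^ 3) := by gcongr
      _ = δ * (4 * (δ / M) ^ 2) := by field_simp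
      _ ≤ δ * 1 := by
        refine mul_le_mul_of_nonneg_left ?_ hδ.le
        nlinarith
      _ = δ := mul_one δ
  have hcompl : (1 : ENNReal) ≤
      P {ω | ∀ i, ‖(N : ℂ)⁻¹ * ∑ j, e i (ω j) - ∫ x, e i x ∂ν‖ ≤ ε} +
      P {ω | ∃ i, ε < ‖(N : ℂ)⁻¹ * ∑ j, e i (ω j) - ∫ x, e i x ∂ν‖} := by
    rw [← measure_univ (μ := P)]
    refine (measure_mono fun ω _ => ?_).trans (measure_union_le _ _)
    by_cases h : ∀ i, ‖(N : ℂ)⁻¹ * ∑ j, e i (ω j) - ∫ x, e i x ∂ν‖ ≤ ε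
    · exact Or.inl h
    · push Not at h
      exact Or.inr h
  have hδP : P {ω | ∃ i, ε < ‖(N : ℂ)⁻¹ * ∑ j, e i (ω j) - ∫ x, e i x ∂ν‖}
      ≤ ENNReal.ofReal δ := by
    rw [← ofReal_measureReal]
    exact ENNReal.ofReal_le_ofReal hunion
  rw [ENNReal.ofReal_sub _ hδ.le, ENNReal.ofReal_one, tsub_le_iff_right]
  exact hcompl.trans (add_le_add le_rfl hδP)

end Concentration

end

end CVBell

theorem mainTheorem5 :
    ∃ C : ℝ, 0 < C ∧
      ∀ (n : ℕ) (U : Matrix.unitaryGroup (Fin n) ℂ), U.1.IsSymm → ∀ ρ : CVBell.QState n,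
        (∃ σ : CVBell.QState n, CVBell.IsReflected U ρ σ) ∧
        ∀ σ : CVBell.QState n, CVBell.IsReflected U ρ σ →
          (∀ ζ : Fin n → ℂ,
            Filter.Tendsto
              (fun K : Finset (Fin n → ℕ) =>
                CVBell.bellDensityTrunc (CVBell.bellInput U ρ σ) K ζ)
              Filter.atTop (nhds (CVBell.bellDensity (CVBell.bellInput U ρ σ) ζ))) ∧
          MeasureTheory.IsProbabilityMeasure (CVBell.bellLaw (CVBell.bellInput U ρ σ)) ∧
          ∀ (M N : ℕ) (α : Fin M → Fin n → ℂ) (ε δ : ℝ),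
            0 < ε → 0 < δ → δ < 1 → 2 * δ ≤ M →
            C * (ε ^ 2)⁻¹ * Real.log (M / δ) ≤ N →
            ENNReal.ofReal (1 - δ) ≤
              (MeasureTheory.Measure.pi
                fun _ : Fin N => CVBell.bellLaw (CVBell.bellInput U ρ σ))
                {ζ | ∀ i, ‖CVBell.estimator ζ (α i) - ρ.χ (α i) ^ 2‖ ≤ ε} := by
  refine ⟨24, by norm_num, fun n U hU ρ => ⟨CVBell.exists_isReflected U hU ρ, fun σ hσ => ?_⟩⟩
  obtain ⟨h1, h2, h3⟩ := CVBell.bellInput_law U ρ σ hσ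
  refine ⟨h1, h2, fun M N α ε δ hε hδ hδ1 hM hN => ?_⟩
  have h := CVBell.ofReal_le_measure_average (ν := CVBell.bellLaw (CVBell.bellInput U ρ σ))
    (e := fun i ζ => Complex.exp (-(ζ ⬝ᵥ α i - star ζ ⬝ᵥ star (α i))))
    (fun i => (CVBell.continuous_phase (α i)).measurable)
    (fun i ζ => (CVBell.norm_phase ζ (α i)).le) hε hδ hδ1 hM hN
  simp only [h3] at h
  exact h
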